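/- Let $\ell\ge 2$ and let $\vec s=(a_1,\dots,a_\ell)$ be a fixed vector of natural numbers with $a_1\ge a_2\ge\cdots\ge a_\ell\ge 0$ and $a_2=\cdots=a_\ell$. A top-$\ell$ vote on a finite set $M$ of candidates is a linear order on an $\ell$-element subset of $M$; it gives $a_j$ points to the candidate in its $j$-th position and $0$ points to every unranked candidate. The score of a candidate in a profile (a finite list of votes) is the sum of its points over all votes, and the winner of the profile is the candidate with the maximum score, ties being broken by a given priority order on $M$. Consider the following decision problem (winner with absent votes, WAV). Input: a finite set $M$ of candidates listed in the order of their tie-breaking priority, a profile $P$ of known top-$\ell$ votes on $M$, the number $t\ge 0$ of absent votes (written in binary), and a candidate $c\in M$. Question: is there a profile $P'$ of $t$ top-$\ell$ votes on $M$ such that $c$ is the winner of the joint profile $P\cup P'$? This problem is decidable by a deterministic Turing machine in time polynomial in the length of the input. -/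

import Mathlib

/-! Winner with absent votes under positional scoring rules on top-`ℓ` votes. -/

namespace WAV

/-- A top-`ℓ` ranking of the candidates `Fin m`: an `ℓ`-subset of the candidates together with a
linear order on it, given as the injective map sending a position (`0` is the top) to the
candidate ranked there. -/
abbrev TopRanking (ℓ m : ℕ) : Type := Fin ℓ ↪ Fin m

/-- The score that candidate `x` gets from one vote: `a j` if `x` is ranked in position `j`,
and `0` if `x` is not ranked. -/
def voteScore {ℓ m : ℕ} (a : Fin ℓ → ℕ) (v : TopRanking ℓ m) (x : Fin m) : ℕ :=
  ∑ j : Fin ℓ, if v j = x then a j else 0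

/-- The total score of candidate `x` in a profile. -/
def score {ℓ m : ℕ} (a : Fin ℓ → ℕ) (P : List (TopRanking ℓ m)) (x : Fin m) : ℕ :=
  (P.map fun v => voteScore a v x).sum

/-- `c` is the winner of the positional scoring rule with scoring vector `a` on the profile `P`:
it has the maximum score, and it comes first in the tie-breaking priority among all candidates
with the maximum score. Here `prio i` is the candidate with the `i`-th highest priority. -/
def IsWinner {ℓ m : ℕ} (a : Fin ℓ → ℕ) (prio : Fin m ≃ Fin m) (P : List (TopRanking ℓ m))
    (c : Fin m) : Prop :=
  (∀ x, score a P x ≤ score a P c) ∧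
    ∀ x, score a P x = score a P c → prio.symm c ≤ prio.symm x

/-- The rule is resolute: every profile has exactly one winner. -/
theorem existsUnique_isWinner {ℓ m : ℕ} (hm : 0 < m) (a : Fin ℓ → ℕ) (prio : Fin m ≃ Fin m)
    (P : List (TopRanking ℓ m)) : ∃! c, IsWinner a prio P c := by
  have : Nonempty (Fin m) := ⟨⟨0, hm⟩⟩
  obtain ⟨y, hy⟩ := Finite.exists_max (score a P)
  obtain ⟨c, hc, hmin⟩ := Finset.exists_min_image
    (Finset.univ.filter fun x => score a P x = score a P y) prio.symm ⟨y, by simp⟩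
  simp only [Finset.mem_filter, Finset.mem_univ, true_and] at hc hmin
  refine ⟨c, ⟨fun x => hc ▸ hy x, fun x hx => hmin x (hx.trans hc)⟩, fun d hd => ?_⟩
  have hdc : score a P d = score a P c := le_antisymm (hc ▸ hy d) (hd.1 c)
  exact prio.symm.injective (le_antisymm (hd.2 c hdc.symm) (hmin d (hdc.trans hc)))

/-- An instance of the problem: the candidates `Fin m`, the tie-breaking priority among them,
the profile of known votes, the number `t` of absent votes, and the target candidate. -/
structure Instance (ℓ : ℕ) where
  /-- the number of candidates -/
  m : ℕ
  /-- `prio i` is the candidate with the `i`-th highest priority in tie-breaking -/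
  prio : Fin m ≃ Fin m
  /-- the known votes -/
  known : List (TopRanking ℓ m)
  /-- the number of absent votes -/
  t : ℕ
  /-- the target candidate -/
  target : Fin m

/-- The YES instances: there is a profile of `t` further votes which, joined to the known votes,
makes the target candidate the winner. -/
def IsYes {ℓ : ℕ} (a : Fin ℓ → ℕ) (I : Instance ℓ) : Prop :=
  ∃ P' : List (TopRanking ℓ I.m),
    P'.length = I.t ∧ IsWinner a I.prio (I.known ++ P') I.target

/-- The input alphabet: binary digits and two separators. -/
inductive Sym : Type
  | bit (b : Bool) : Sym
  | comma : Sym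
  | semi : Sym
  deriving DecidableEq, Fintype

/-- A natural number in binary, terminated by a comma. -/
def encodeNum (n : ℕ) : List Sym :=
  (Computability.encodeNat n).map Sym.bit ++ [Sym.comma]

/-- A list of natural numbers in binary, terminated by a semicolon. -/
def encodeNums (l : List ℕ) : List Sym :=
  l.flatMap encodeNum ++ [Sym.semi]

/-- The input string of an instance: the target candidate, the number of absent votes in binary,
the list of all candidates in order of priority, and the list of the known votes, each being the
list of its candidates from the top position down. -/
def encode {ℓ : ℕ} (I : Instance ℓ) : List Sym :=
  encodeNum I.target ++ encodeNum I.t ++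
    encodeNums (List.ofFn fun i => (I.prio i : ℕ)) ++
    I.known.flatMap fun v => encodeNums (List.ofFn fun j => (v j : ℕ))

theorem encodeNum_append_inj {n k : ℕ} {u v : List Sym}
    (h : encodeNum n ++ u = encodeNum k ++ v) : n = k ∧ u = v := by
  have key : ∀ (xs ys : List Bool), xs.map Sym.bit ++ Sym.comma :: u =
      ys.map Sym.bit ++ Sym.comma :: v → xs = ys ∧ u = v := by
    intro xs
    induction xs with
    | nil => intro ys h; cases ys <;> simp_all
    | cons x xs ih =>
      intro ys h
      cases ys with
      | nil => simp at h
      | cons y ys =>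
        simp only [List.map_cons, List.cons_append, List.cons.injEq, Sym.bit.injEq] at h
        obtain ⟨h1, h2⟩ := ih ys h.2
        exact ⟨by rw [h.1, h1], h2⟩
  obtain ⟨h1, h2⟩ := key _ _ (by simpa [encodeNum] using h)
  refine ⟨?_, h2⟩
  rw [← Computability.decode_encodeNat n, h1, Computability.decode_encodeNat]

theorem encodeNums_append_inj {l k : List ℕ} {u v : List Sym}
    (h : encodeNums l ++ u = encodeNums k ++ v) : l = k ∧ u = v := by
  have hne : ∀ (n : ℕ) (w w' : List Sym), Sym.semi :: w ≠ encodeNum n ++ w' := by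
    intro n w w' h
    unfold encodeNum at h
    cases hb : Computability.encodeNat n <;> simp [hb] at h
  induction l generalizing k with
  | nil =>
    cases k with
    | nil => simpa [encodeNums] using h
    | cons y ys => exact absurd (by simpa [encodeNums] using h) (hne y u _)
  | cons x xs ih =>
    cases k with
    | nil => exact absurd (by simpa [encodeNums] using h.symm) (hne x v _)
    | cons y ys =>
      have h' : encodeNum x ++ (encodeNums xs ++ u) = encodeNum y ++ (encodeNums ys ++ v) := by
        simpa [encodeNums] using h
      obtain ⟨h1, h2⟩ := encodeNum_append_inj h'
      obtain ⟨h3, h4⟩ := ih h2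
      exact ⟨by rw [h1, h3], h4⟩

/-- Different instances have different input strings. -/
theorem encode_injective (ℓ : ℕ) : Function.Injective (encode (ℓ := ℓ)) := by
  rintro ⟨m, p, P, t, c⟩ ⟨m', p', P', t', c'⟩ h
  simp only [encode, List.append_assoc] at h
  obtain ⟨hc, h⟩ := encodeNum_append_inj h
  obtain ⟨ht, h⟩ := encodeNum_append_inj h
  obtain ⟨hp, h⟩ := encodeNums_append_inj h
  have hm : m = m' := by simpa using congrArg List.length hp
  subst hm
  have hc' : c = c' := Fin.ext hc
  have hp' : p = p' := by
    ext i
    exact congrFun (List.ofFn_injective hp) i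
  subst ht hc' hp'
  have key : ∀ Q Q' : List (TopRanking ℓ m),
      (Q.flatMap fun v => encodeNums (List.ofFn fun j => (v j : ℕ))) =
        (Q'.flatMap fun v => encodeNums (List.ofFn fun j => (v j : ℕ))) → Q = Q' := by
    intro Q
    induction Q with
    | nil =>
      intro Q' h
      cases Q' with
      | nil => rfl
      | cons w Q' => exact absurd h (by simp [encodeNums])
    | cons v Q ih =>
      intro Q' h
      cases Q' with
      | nil => exact absurd h (by simp [encodeNums])
      | cons w Q' =>
        simp only [List.flatMap_cons] at h
        obtain ⟨h1, h2⟩ := encodeNums_append_inj h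
        have hvw : v = w := by
          ext i
          exact congrFun (List.ofFn_injective h1) i
        rw [hvw, ih Q' h2]
  have hP : P = P' := key P P' h
  subst hP
  rfl

open Classical in
/-- The decision problem `L` on inputs of type `α`, written as strings by `enc`, is decided by a
deterministic Turing machine (with finitely many states, labels and stacks, and finite stack
alphabets) in time polynomial in the length of the input string. -/
def DecidableInPolyTime {α Γ : Type} (enc : α → List Γ) (L : α → Prop) : Prop :=
  ∃ M : Turing.TM2ComputableInPolyTime enc Computability.encodeBool (fun x => decide (L x)),
    ∀ k, Finite (M.tm.Γ k)

end WAV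

/-! The target `c` wins with `t` absent votes if and only if it can win when all of them rank it
first. Another candidate that is also ranked in all of them exceeds the final score of `c` by some
number of points, so it has to be left out of enough votes; its capacity is the largest number of
votes that may rank it. All positions but the first give the same number of points, so only the
number of votes that rank each candidate matters, and suitable votes exist if and only if no
candidate beats `c` even when it is left out of all of them, and the capacities, with `t` for `c`,
add up to at least `t * ℓ`. The truth of this criterion no longer depends on `t` once `t` is at
least the sum of the known scores plus the number of candidates, which is linear in the length of
the input. So it can be evaluated in polynomial time in unary arithmetic, by loop programs on
registers that hold strings, and these compile to machines with stacks. -/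

section PolynomialTime

open Turing Function Finset

/-- Programs on registers numbered by `ℕ`, each holding a string over `A`. The only control
structure is a loop over the symbols of a register, so every program terminates. -/
inductive LoopProgram (A : Type) : Type
  | skip : LoopProgram A
  | push (k : ℕ) (a : A) : LoopProgram A
  | seq (p q : LoopProgram A) : LoopProgram A
  | forEach (k : ℕ) (body : A → LoopProgram A) : LoopProgram A

infixr:60 ";;" => LoopProgram.seq

namespace LoopProgram

variable {A : Type}

/-- The effect of a program on the registers. A loop first empties its register, and then runs the
body on its former symbols, beginning with the last one. -/
def run : LoopProgram A → (ℕ → List A) → ℕ → List A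
  | skip, s => s
  | push k a, s => update s k (a :: s k)
  | p ;; q, s => q.run (p.run s)
  | forEach k body, s => (s k).foldr (fun a => (body a).run) (update s k [])

/-- The cost of folding the updates `f` over a list, if `c a s` is the cost of the update `f a` in
the state `s` and each update has an overhead of `1`. -/
def foldCost {S : Type} (f : A → S → S) (c : A → S → ℕ) (s : S) : List A → ℕ
  | [] => 0
  | a :: l => foldCost f c s l + (1 + c a (l.foldr f s))

/-- The number of steps of the compiled Turing machine. A loop first moves the symbols of its
register to a private stack, one by one. -/
def cost : LoopProgram A → (ℕ → List A) → ℕ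
  | skip, _ => 1
  | push _ _, _ => 1
  | p ;; q, s => p.cost s + q.cost (p.run s)
  | forEach k body, s =>
    (s k).length + 1 + (foldCost (fun a => (body a).run) (fun a => (body a).cost)
      (update s k []) (s k) + 1)

/-- All registers of the program are at most `N`. -/
def RegistersLE (N : ℕ) : LoopProgram A → Prop
  | skip => True
  | push k _ => k ≤ N
  | p ;; q => p.RegistersLE N ∧ q.RegistersLE N
  | forEach k body => k ≤ N ∧ ∀ a, (body a).RegistersLE N

theorem RegistersLE.mono {N N' : ℕ} (h : N ≤ N') :
    ∀ {p : LoopProgram A}, p.RegistersLE N → p.RegistersLE N'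
  | skip, _ => trivial
  | push _ _, hp => le_trans hp h
  | _ ;; _, hp => ⟨hp.1.mono h, hp.2.mono h⟩
  | forEach _ _, hp => ⟨hp.1.trans h, fun a => (hp.2 a).mono h⟩

theorem exists_registersLE [Finite A] : ∀ p : LoopProgram A, ∃ N, p.RegistersLE N
  | skip => ⟨0, trivial⟩
  | push k _ => ⟨k, le_rfl⟩
  | p ;; q => by
    obtain ⟨N, hp⟩ := exists_registersLE p
    obtain ⟨N', hq⟩ := exists_registersLE q
    exact ⟨max N N', hp.mono (le_max_left _ _), hq.mono (le_max_right _ _)⟩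
  | forEach k body => by
    choose N hN using fun a => exists_registersLE (body a)
    obtain ⟨B, hB⟩ := (Set.finite_range N).bddAbove
    exact ⟨max k B, le_max_left _ _,
      fun a => (hN a).mono ((hB (Set.mem_range_self a)).trans (le_max_right _ _))⟩

theorem length_run_le (p : LoopProgram A) (s : ℕ → List A) (i : ℕ) :
    (p.run s i).length ≤ (s i).length + p.cost s := by
  induction p generalizing s with
  | skip => exact Nat.le_add_right _ _
  | push k a =>
    by_cases h : i = k
    · subst h; simp [run, cost]
    · simp [run, h]
  | seq p q hp hq =>
    have := hp s
    have := hq (p.run s)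
    simp only [run, cost]
    omega
  | forEach k body ih =>
    have key : ∀ l, (l.foldr (fun a => (body a).run) (update s k []) i).length ≤
        (s i).length + foldCost (fun a => (body a).run) (fun a => (body a).cost)
          (update s k []) l := by
      intro l
      induction l with
      | nil => by_cases h : i = k <;> simp [h]
      | cons a l hl =>
        have := ih a (l.foldr (fun a => (body a).run) (update s k []))
        simp only [List.foldr_cons, foldCost]
        omega
    have := key (s k)
    simp only [run, cost]
    omega

section Compile

/-- The control points of a program. A loop has one for moving its register to a private stack, one
for popping that stack, and those of its bodies. -/
def Label : LoopProgram A → Type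
  | skip => Unit
  | push _ _ => Unit
  | p ;; q => p.Label ⊕ q.Label
  | forEach _ body => Bool ⊕ Σ a, (body a).Label

instance finite_label [Finite A] : ∀ p : LoopProgram A, Finite p.Label
  | skip => inferInstanceAs (Finite Unit)
  | push _ _ => inferInstanceAs (Finite Unit)
  | p ;; q =>
    have := finite_label p
    have := finite_label q
    inferInstanceAs (Finite (p.Label ⊕ q.Label))
  | forEach _ body =>
    have := fun a => finite_label (body a)
    inferInstanceAs (Finite (Bool ⊕ Σ a, (body a).Label))

/-- The control point at which a program starts. -/
def entry : (p : LoopProgram A) → p.Label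
  | skip => ()
  | push _ _ => ()
  | p ;; _ => Sum.inl p.entry
  | forEach _ _ => Sum.inl false

/-- The stacks of a machine with labels `Λ`: one for the answer, one for each register, and one for
each label, which is private to the loop at that label. -/
abbrev Stack (N : ℕ) (Λ : Type) : Type := Option (Fin (N + 1) ⊕ Λ)

/-- The stack alphabets: the answer is a Boolean. -/
abbrev StackSymbol (A : Type) {N : ℕ} {Λ : Type} : Stack N Λ → Type
  | none => Bool
  | some _ => A

variable {Λ : Type} {N : ℕ}

/-- The stack of the register `k`, provided that `k ≤ N`. -/
abbrev register (N k : ℕ) : Stack N Λ := some (.inl (Fin.ofNat (N + 1) k))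

/-- The private stack of the loop at the label `l`. -/
abbrev loopStack (N : ℕ) (l : Λ) : Stack N Λ := some (.inr l)

/-- The statement at a control point of a program that is embedded by `ι` into a machine with
labels `Λ` and is left to the label `exit`. -/
def compile [Inhabited A] (N : ℕ) : (p : LoopProgram A) → (p.Label → Λ) → Λ → p.Label →
    TM2.Stmt (StackSymbol A (N := N) (Λ := Λ)) Λ (Option A)
  | skip, _, exit, _ => .goto fun _ => exit
  | push k a, _, exit, _ => .push (register N k) (fun _ => a) (.goto fun _ => exit)
  | p ;; q, ι, _, .inl l => compile N p (ι ∘ .inl) (ι (.inr q.entry)) l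
  | _ ;; q, ι, exit, .inr l => compile N q (ι ∘ .inr) exit l
  | forEach k _, ι, _, .inl false =>
    .pop (register N k) (fun _ o => o) (.branch Option.isSome
      (.push (loopStack N (ι (.inl true))) (fun o => o.getD default)
        (.goto fun _ => ι (.inl false)))
      (.goto fun _ => ι (.inl true)))
  | forEach _ body, ι, exit, .inl true =>
    .pop (loopStack N (ι (.inl true))) (fun _ o => o) (.goto fun o =>
      o.elim exit fun a => ι (.inr ⟨a, (body a).entry⟩))
  | forEach _ body, ι, _, .inr ⟨a, l⟩ =>
    compile N (body a) (fun l => ι (.inr ⟨a, l⟩)) (ι (.inl true)) l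

/-- The stack contents with registers `s`, private contents `h`, and an empty answer stack. -/
def contents (N : ℕ) (s : ℕ → List A) (h : Λ → List A) : ∀ k : Stack N Λ, List (StackSymbol A k)
  | none => []
  | some (.inl i) => s i
  | some (.inr l) => h l

theorem contents_register {k : ℕ} (hk : k ≤ N) (s : ℕ → List A) (h : Λ → List A) :
    contents N s h (register N k) = s k :=
  congrArg s (Nat.mod_eq_of_lt (Nat.lt_succ_of_le hk))

theorem contents_update_register [DecidableEq Λ] {k : ℕ} (hk : k ≤ N) (s : ℕ → List A)
    (h : Λ → List A) (l : List A) :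
    contents N (update s k l) h = update (contents N s h) (register N k) l := by
  refine eq_update_iff.mpr ⟨by rw [contents_register hk, update_self], fun k' hk' => ?_⟩
  rcases k' with _ | i | l'
  · rfl
  · exact update_of_ne (fun e : (i : ℕ) = k => hk' (by simp [← e])) l s
  · rfl

theorem contents_loopStack (s : ℕ → List A) (h : Λ → List A) (l : Λ) :
    contents N s h (loopStack N l) = h l :=
  rfl

theorem contents_update_loopStack [DecidableEq Λ] (s : ℕ → List A) (h : Λ → List A) (k : Λ)
    (l : List A) :
    contents N s (update h k l) = update (contents N s h) (loopStack N k) l := by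
  refine eq_update_iff.mpr ⟨by simp [contents, loopStack], fun k' hk' => ?_⟩
  rcases k' with _ | i | l'
  · rfl
  · rfl
  · exact update_of_ne (fun e : l' = k => hk' (by rw [e])) l h

theorem contents_nil :
    contents N (fun _ => ([] : List A)) (fun _ : Λ => []) = fun _ => [] := by
  funext k
  rcases k with _ | i | l <;> rfl

/-- The configuration `c'` is reached from `c` in `n` steps. -/
def ReachesIn {K : Type} [DecidableEq K] {Γ : K → Type} {Λ σ : Type} (M : Λ → TM2.Stmt Γ Λ σ)
    (n : ℕ) (c c' : TM2.Cfg Γ Λ σ) : Prop :=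
  (flip bind (TM2.step M))^[n] (some c) = some c'

theorem ReachesIn.trans {K : Type} [DecidableEq K] {Γ : K → Type} {Λ σ : Type}
    {M : Λ → TM2.Stmt Γ Λ σ} {n n' : ℕ} {c c' c'' : TM2.Cfg Γ Λ σ}
    (h : ReachesIn M n c c') (h' : ReachesIn M n' c' c'') : ReachesIn M (n + n') c c'' := by
  unfold ReachesIn at *
  rw [add_comm, iterate_add_apply, h, h']

theorem ReachesIn.single {K : Type} [DecidableEq K] {Γ : K → Type} {Λ σ : Type}
    {M : Λ → TM2.Stmt Γ Λ σ} {l : Λ} {q : TM2.Stmt Γ Λ σ} {v : σ} {S : ∀ k, List (Γ k)}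
    {c : TM2.Cfg Γ Λ σ} (hM : M l = q) (h : TM2.stepAux q v S = c) :
    ReachesIn M 1 ⟨some l, v, S⟩ c := by
  rw [← h, ← hM]
  rfl

variable [DecidableEq Λ] [Inhabited A]
  {M : Λ → TM2.Stmt (StackSymbol A (N := N) (Λ := Λ)) Λ (Option A)}

theorem reachesIn_transfer {k : ℕ} (hk : k ≤ N) {body : A → LoopProgram A}
    {ι : (forEach k body).Label → Λ} {exit : Λ}
    (hM : M (ι (.inl false)) = compile N (forEach k body) ι exit (.inl false))
    (s : ℕ → List A) (h : Λ → List A) (v : Option A) :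
    ReachesIn M ((s k).length + 1) ⟨some (ι (.inl false)), v, contents N s h⟩
      ⟨some (ι (.inl true)), none, contents N (update s k [])
        (update h (ι (.inl true)) ((s k).reverse ++ h (ι (.inl true))))⟩ := by
  generalize hl : s k = l
  induction l generalizing s h v with
  | nil => exact .single hM (by
      simp [compile, contents_register hk, contents_update_register hk, hl])
  | cons a l ih =>
    have h₁ : ReachesIn M 1 ⟨some (ι (.inl false)), v, contents N s h⟩
        ⟨some (ι (.inl false)), some a, contents N (update s k l)
          (update h (ι (.inl true)) (a :: h (ι (.inl true))))⟩ :=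
      .single hM (by
        rw [contents_update_loopStack, contents_update_register hk]
        simp [compile, contents_register hk, contents_loopStack, hl])
    have h₂ := ih (update s k l) (update h (ι (.inl true)) (a :: h (ι (.inl true)))) (some a)
      (by simp)
    simpa [add_comm] using h₁.trans h₂

/-- `p` is simulated by every machine in which it is embedded injectively, from configurations in
which its private stacks are empty. -/
def IsSimulated (N : ℕ) (p : LoopProgram A) : Prop :=
  ∀ {Λ : Type} [DecidableEq Λ] (M : Λ → TM2.Stmt (StackSymbol A (N := N) (Λ := Λ)) Λ (Option A))
    (ι : p.Label → Λ) (exit : Λ), Injective ι → (∀ l, M (ι l) = compile N p ι exit l) →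
    ∀ (s : ℕ → List A) (h : Λ → List A) (v : Option A), (∀ l, h (ι l) = []) →
    ∃ v', ReachesIn M (p.cost s) ⟨some (ι p.entry), v, contents N s h⟩
      ⟨some exit, v', contents N (p.run s) h⟩

theorem reachesIn_iterate {k : ℕ} {body : A → LoopProgram A}
    (ih : ∀ a, IsSimulated N (body a)) {ι : (forEach k body).Label → Λ} {exit : Λ}
    (hι : Injective ι) (hM : ∀ l, M (ι l) = compile N (forEach k body) ι exit l)
    (l t : List A) (s : ℕ → List A) (h : Λ → List A) (hh : ∀ l, h (ι (.inr l)) = [])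
    (v : Option A) :
    ∃ v', ReachesIn M (foldCost (fun a => (body a).run) (fun a => (body a).cost) s l)
      ⟨some (ι (.inl true)), v, contents N s (update h (ι (.inl true)) (l.reverse ++ t))⟩
      ⟨some (ι (.inl true)), v', contents N (l.foldr (fun a => (body a).run) s)
        (update h (ι (.inl true)) t)⟩ := by
  induction l generalizing t v with
  | nil => exact ⟨v, rfl⟩
  | cons a l ihl =>
    obtain ⟨v', h₁⟩ := ihl (a :: t) v
    have h₂ : ReachesIn M 1
        ⟨some (ι (.inl true)), v', contents N (l.foldr (fun a => (body a).run) s)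
          (update h (ι (.inl true)) (a :: t))⟩
        ⟨some (ι (.inr ⟨a, (body a).entry⟩)), some a, contents N
          (l.foldr (fun a => (body a).run) s) (update h (ι (.inl true)) t)⟩ :=
      .single (hM _) (by simp [compile, contents_update_loopStack])
    obtain ⟨v'', h₃⟩ := ih a M (fun l => ι (.inr ⟨a, l⟩)) (ι (.inl true))
      (fun l l' e => eq_of_heq (Sigma.mk.inj_iff.mp (Sum.inr.inj (hι e))).2) (fun l => hM _)
      (l.foldr (fun a => (body a).run) s) (update h (ι (.inl true)) t) (some a) (fun l => by
        rw [update_of_ne (hι.ne Sum.inr_ne_inl), hh])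
    refine ⟨v'', ?_⟩
    rw [List.reverse_cons, List.append_assoc]
    exact h₁.trans (h₂.trans h₃)

theorem isSimulated_forEach {k : ℕ} (hk : k ≤ N) {body : A → LoopProgram A}
    (ih : ∀ a, IsSimulated N (body a)) : IsSimulated N (forEach k body) := by
  intro Λ _ M ι exit hι hM s h v hh
  have hempty : update h (ι (.inl true)) [] = h := by rw [← hh (.inl true), update_eq_self]
  have transfer := reachesIn_transfer hk (hM (.inl false)) s h v
  obtain ⟨v', iterate⟩ := reachesIn_iterate ih hι hM (s k) [] (update s k []) h
    (fun l => hh _) none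
  rw [hh (.inl true)] at transfer
  rw [hempty] at iterate
  have leave : ReachesIn M 1 ⟨some (ι (.inl true)), v', contents N ((forEach k body).run s) h⟩
      ⟨some exit, none, contents N ((forEach k body).run s) h⟩ :=
    .single (hM _) (by
      simp [compile, contents_loopStack, ← contents_update_loopStack, hh (.inl true), hempty])
  exact ⟨none, transfer.trans (iterate.trans leave)⟩

theorem isSimulated : ∀ {p : LoopProgram A}, p.RegistersLE N → IsSimulated N p
  | skip, _ => fun M ι exit _ hM s h v _ => ⟨v, .single (hM _) rfl⟩
  | push k a, hk => fun M ι exit _ hM s h v _ => ⟨v, .single (hM _) (by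
      simp [compile, run, contents_update_register hk, contents_register hk])⟩
  | p ;; q, hpq => fun M ι exit hι hM s h v hh => by
    obtain ⟨v', h₁⟩ := isSimulated hpq.1 M (ι ∘ .inl) (ι (.inr q.entry))
      (hι.comp Sum.inl_injective) (fun l => hM (.inl l)) s h v (fun l => hh (.inl l))
    obtain ⟨v'', h₂⟩ := isSimulated hpq.2 M (ι ∘ .inr) exit
      (hι.comp Sum.inr_injective) (fun l => hM (.inr l)) (p.run s) h v' (fun l => hh (.inr l))
    exact ⟨v'', h₁.trans h₂⟩
  | forEach k body, hk => isSimulated_forEach hk.1 fun a => isSimulated (hk.2 a)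

end Compile

section Machine

variable [Fintype A] [Inhabited A]

/-- The code of the machine of a program: at the end of the program it moves the answer from the
register `1`, in which any symbol means yes, to the answer stack. -/
def code (N : ℕ) (p : LoopProgram A) : Option p.Label →
    TM2.Stmt (StackSymbol A (N := N) (Λ := Option p.Label)) (Option p.Label) (Option A)
  | some l => compile N p some none l
  | none => .pop (register N 1) (fun _ o => o)
      (.push none Option.isSome (.load (fun _ => none) .halt))

open Classical in
/-- The machine of a program with input register `0` and answer register `1`. -/
noncomputable def machine (N : ℕ) (p : LoopProgram A) : FinTM2 where
  K := Stack N (Option p.Label)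
  kFin := Fintype.ofFinite _
  k₀ := register N 0
  k₁ := none
  Γ := StackSymbol A
  Λ := Option p.Label
  main := some p.entry
  ΛFin := Fintype.ofFinite _
  σ := Option A
  initialState := none
  Γk₀Fin := inferInstanceAs (Fintype A)
  m := code N p

theorem stk_initList (tm : FinTM2) (w : List (tm.Γ tm.k₀)) :
    (initList tm w).stk = update (fun _ => []) tm.k₀ w := by
  funext k
  by_cases h : k = tm.k₀
  · subst h; simp [initList]
  · simp [initList, h]

theorem stk_haltList (tm : FinTM2) (w : List (tm.Γ tm.k₁)) :
    (haltList tm w).stk = update (fun _ => []) tm.k₁ w := by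
  funext k
  by_cases h : k = tm.k₁
  · subst h; simp [haltList]
  · simp [haltList, h]

theorem initList_machine (N : ℕ) (p : LoopProgram A) (w : List A) :
    initList (machine N p) w =
      ⟨some (some p.entry), none, contents N (update (fun _ => []) 0 w) fun _ => []⟩ := by
  classical
  rw [contents_update_register (Nat.zero_le N), contents_nil]
  exact congrArg (TM2.Cfg.mk _ _) (stk_initList (machine N p) w)

open Classical in
theorem haltList_machine (N : ℕ) (p : LoopProgram A) (b : Bool) :
    haltList (machine N p) [b] = ⟨none, none, update (fun _ => []) none [b]⟩ :=
  congrArg (TM2.Cfg.mk _ _) (stk_haltList (machine N p) [b])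

theorem nonempty_outputsInTime {N : ℕ} (hN : 1 ≤ N) {p : LoopProgram A} (hp : p.RegistersLE N)
    {w : List A} {b : Bool}
    (h : p.run (update (fun _ => []) 0 w) = update (fun _ => []) 1 (List.replicate b.toNat default))
    {n : ℕ} (hn : p.cost (update (fun _ => []) 0 w) ≤ n) :
    Nonempty (TM2OutputsInTime (machine N p) w (some [b]) (n + 1)) := by
  classical
  obtain ⟨v, h₁⟩ := isSimulated hp (code N p) some none (Option.some_injective _) (fun _ => rfl)
    (update (fun _ => []) 0 w) (fun _ => []) none (fun _ => rfl)
  have h₂ : ReachesIn (code N p) 1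
      ⟨some none, v, contents N (p.run (update (fun _ => []) 0 w)) fun _ => []⟩
      ⟨none, none, update (fun _ => []) none [b]⟩ := by
    refine .single rfl ?_
    rw [h, contents_update_register hN, contents_nil]
    cases b <;> simp [code]
  refine ⟨⟨⟨p.cost (update (fun _ => []) 0 w) + 1, ?_⟩, Nat.succ_le_succ hn⟩⟩
  rw [initList_machine, Option.map_some, haltList_machine]
  exact h₁.trans h₂

end Machine

open Classical in
theorem decidableInPolyTime_of_run [Finite A] [Inhabited A] {α : Type} {enc : α → List A}
    {L : α → Prop} (p : LoopProgram A) (P : Polynomial ℕ)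
    (hrun : ∀ x, p.run (update (fun _ => []) 0 (enc x)) =
      update (fun _ => []) 1 (List.replicate (decide (L x)).toNat default))
    (hcost : ∀ x, p.cost (update (fun _ => []) 0 (enc x)) ≤ P.eval (enc x).length) :
    WAV.DecidableInPolyTime enc L := by
  have := Fintype.ofFinite A
  obtain ⟨N, hN⟩ := p.exists_registersLE
  have hp := hN.mono (Nat.le_succ N)
  refine ⟨⟨⟨machine (N + 1) p, Equiv.refl _, Equiv.refl _⟩, P + 1, fun x => ?_⟩, ?_⟩
  · refine Classical.choice ?_
    have hw : (enc x).map (Equiv.refl A).invFun = enc x := List.map_id _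
    have := nonempty_outputsInTime (Nat.le_add_left 1 N) hp (hrun x) (hcost x)
    rw [Polynomial.eval_add, Polynomial.eval_one]
    exact cast (congrArg (fun w => Nonempty (TM2OutputsInTime (machine (N + 1) p) w _ _)) hw.symm)
      this
  · rintro (_ | k)
    · exact inferInstanceAs (Finite Bool)
    · exact inferInstanceAs (Finite A)

end LoopProgram

theorem monotone_polynomial_eval (P : Polynomial ℕ) : Monotone fun n => P.eval n := by
  intro m n h
  simp only [Polynomial.eval_eq_sum_range]
  gcongr

/-- `f` is bounded by a polynomial in `n`. -/
def PolyBounded {X : Type} (n f : X → ℕ) : Prop :=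
  ∃ P : Polynomial ℕ, ∀ x, f x ≤ P.eval (n x)

namespace PolyBounded

variable {X : Type} {n f g : X → ℕ}

theorem refl (n : X → ℕ) : PolyBounded n n :=
  ⟨Polynomial.X, fun x => by simp⟩

theorem const (n : X → ℕ) (c : ℕ) : PolyBounded n fun _ => c :=
  ⟨Polynomial.C c, fun x => by simp⟩

theorem of_le (hg : PolyBounded n g) (h : ∀ x, f x ≤ g x) : PolyBounded n f := by
  obtain ⟨P, hP⟩ := hg
  exact ⟨P, fun x => (h x).trans (hP x)⟩

theorem add (hf : PolyBounded n f) (hg : PolyBounded n g) : PolyBounded n fun x => f x + g x := by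
  obtain ⟨P, hP⟩ := hf
  obtain ⟨Q, hQ⟩ := hg
  exact ⟨P + Q, fun x => by simpa using add_le_add (hP x) (hQ x)⟩

theorem mul (hf : PolyBounded n f) (hg : PolyBounded n g) : PolyBounded n fun x => f x * g x := by
  obtain ⟨P, hP⟩ := hf
  obtain ⟨Q, hQ⟩ := hg
  exact ⟨P * Q, fun x => by simpa using Nat.mul_le_mul (hP x) (hQ x)⟩

theorem sum {ι : Type} {s : Finset ι} {f : ι → X → ℕ} (h : ∀ i ∈ s, PolyBounded n (f i)) :
    PolyBounded n fun x => ∑ i ∈ s, f i x := by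
  choose! P hP using h
  exact ⟨∑ i ∈ s, P i, fun x => by
    simpa [Polynomial.eval_finsetSum] using sum_le_sum fun i hi => hP i hi x⟩

theorem trans (hf : PolyBounded g f) (hg : PolyBounded n g) : PolyBounded n f := by
  obtain ⟨P, hP⟩ := hf
  obtain ⟨Q, hQ⟩ := hg
  refine ⟨P.comp Q, fun x => (hP x).trans ?_⟩
  rw [Polynomial.eval_comp]
  exact monotone_polynomial_eval P (hQ x)

theorem comp {Y : Type} (hf : PolyBounded n f) (e : Y → X) :
    PolyBounded (fun y => n (e y)) fun y => f (e y) := by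
  obtain ⟨P, hP⟩ := hf
  exact ⟨P, fun y => hP (e y)⟩

end PolyBounded

namespace LoopProgram

variable {A : Type}

theorem foldCost_le {S : Type} {f : A → S → S} {c : A → S → ℕ} {s : S} {l : List A} {B : ℕ}
    (h : ∀ a t, a :: t <:+ l → c a (t.foldr f s) ≤ B) : foldCost f c s l ≤ l.length * (B + 1) := by
  induction l with
  | nil => exact Nat.zero_le _
  | cons a l ih =>
    have h₁ := ih fun a t ht => h a t (ht.trans (List.suffix_cons _ _))
    have h₂ := h a l List.suffix_rfl
    simp only [foldCost, List.length_cons, add_one_mul]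
    omega

/-- Empty the register `k`. -/
def clear (k : ℕ) : LoopProgram A := forEach k fun _ => skip

/-- Move the contents of the register `k` to the front of the register `k'`. -/
def move (k k' : ℕ) : LoopProgram A := forEach k fun a => push k' a

/-- Copy the contents of the register `k` to the front of the register `k'`. -/
def copy (k k' : ℕ) : LoopProgram A := forEach k fun a => push k a ;; push k' a

theorem foldr_run_eq {body : A → LoopProgram A} {state : List A → ℕ → List A}
    (h : ∀ a t, (body a).run (state t) = state (a :: t)) (l : List A) :
    l.foldr (fun a => (body a).run) (state []) = state l := by
  induction l with
  | nil => rfl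
  | cons a l ih => rw [List.foldr_cons, ih, h]

section ForEach

variable {k : ℕ} {body : A → LoopProgram A} {s : ℕ → List A} {state : List A → ℕ → List A} {B : ℕ}

theorem run_forEach_eq (hinit : update s k [] = state [])
    (h : ∀ a t, (body a).run (state t) = state (a :: t)) :
    (forEach k body).run s = state (s k) := by
  rw [run, hinit, foldr_run_eq h]

theorem cost_forEach_le (h : ∀ a t, a :: t <:+ s k →
      (body a).cost (t.foldr (fun a => (body a).run) (update s k [])) ≤ B) :
    (forEach k body).cost s ≤ (s k).length * (B + 2) + 2 := by
  have := foldCost_le (f := fun a => (body a).run) (c := fun a => (body a).cost) h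
  simp only [cost]
  linarith

theorem cost_forEach_le_of_run_eq (hinit : update s k [] = state [])
    (h : ∀ a t, (body a).run (state t) = state (a :: t))
    (hB : ∀ a t, a :: t <:+ s k → (body a).cost (state t) ≤ B) :
    (forEach k body).cost s ≤ (s k).length * (B + 2) + 2 :=
  cost_forEach_le fun a t ht => by rw [hinit, foldr_run_eq h]; exact hB a t ht

end ForEach

theorem run_clear (k : ℕ) (s : ℕ → List A) : (clear k).run s = update s k [] :=
  run_forEach_eq (state := fun _ => update s k []) rfl fun _ _ => rfl

theorem run_move {k k' : ℕ} (s : ℕ → List A) (hk : k ≠ k') :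
    (move k k').run s = update (update s k []) k' (s k ++ s k') :=
  run_forEach_eq (state := fun l => update (update s k []) k' (l ++ s k'))
    (by simp [hk.symm]) fun a l => by simp [run]

theorem run_copy {k k' : ℕ} (s : ℕ → List A) (hk : k ≠ k') :
    (copy k k').run s = update s k' (s k ++ s k') :=
  (run_forEach_eq (state := fun l => update (update s k l) k' (l ++ s k'))
    (by simp [hk.symm]) fun a l => by simp [run, hk, hk.symm, update_comm hk]).trans
    (by rw [update_eq_self])

theorem cost_clear_le (k : ℕ) (s : ℕ → List A) : (clear k).cost s ≤ (s k).length * 3 + 2 :=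
  cost_forEach_le fun _ _ _ => le_rfl

theorem cost_move_le (k k' : ℕ) (s : ℕ → List A) : (move k k').cost s ≤ (s k).length * 3 + 2 :=
  cost_forEach_le fun _ _ _ => le_rfl

theorem cost_copy_le (k k' : ℕ) (s : ℕ → List A) : (copy k k').cost s ≤ (s k).length * 4 + 2 :=
  cost_forEach_le fun _ _ _ => le_rfl

/-- The total length of the registers below `m`. -/
def sizeBelow (m : ℕ) (s : ℕ → List A) : ℕ := ∑ i ∈ range m, (s i).length

theorem length_le_sizeBelow {m i : ℕ} (hi : i < m) (s : ℕ → List A) :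
    (s i).length ≤ sizeBelow m s :=
  single_le_sum (f := fun i => (s i).length) (fun _ _ => Nat.zero_le _) (mem_range.mpr hi)

theorem sizeBelow_update (m : ℕ) (s : ℕ → List A) (w : List A) :
    sizeBelow (m + 1) (update s m w) = sizeBelow m s + w.length := by
  rw [sizeBelow, sum_range_succ, update_self]
  congr 1
  exact sum_congr rfl fun i hi => by rw [update_of_ne (mem_range.mp hi).ne]

/-- A program computes `f`, in time polynomial in the total length of the registers below `m`: when
it is started with the registers `env x`, it writes `f x` to the register `m` and leaves all other
registers as they were. -/
def Computes {X : Type} (env : X → ℕ → List A) (m : ℕ) (f : X → List A) : Prop :=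
  ∃ p : LoopProgram A, (∀ x, p.run (env x) = update (env x) m (f x)) ∧
    PolyBounded (fun x => sizeBelow m (env x)) fun x => p.cost (env x)

namespace Computes

variable {X : Type} {env : X → ℕ → List A} {m : ℕ} {f g : X → List A}

theorem polyBounded_length (h : Computes env m f) (hm : ∀ x, env x m = []) :
    PolyBounded (fun x => sizeBelow m (env x)) fun x => (f x).length := by
  obtain ⟨p, hp, hcost⟩ := h
  exact hcost.of_le fun x => by simpa [hp x, hm] using p.length_run_le (env x) m

theorem nil (hm : ∀ x, env x m = []) : Computes env m fun _ => [] :=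
  ⟨skip, fun x => by rw [← hm x, update_eq_self]; rfl, .const _ 1⟩

theorem cons (a : A) (h : Computes env m f) : Computes env m fun x => a :: f x := by
  obtain ⟨p, hp, hcost⟩ := h
  exact ⟨p ;; push m a, fun x => by simp [run, hp x], hcost.add (.const _ 1)⟩

theorem register {i : ℕ} (hi : i < m) (hm : ∀ x, env x m = []) :
    Computes env m fun x => env x i :=
  ⟨copy i m, fun x => by simp [run_copy _ hi.ne, hm],
    (((PolyBounded.refl _).of_le fun x => length_le_sizeBelow hi (env x)).mul (.const _ 4)).add
      (.const _ 2) |>.of_le fun x => cost_copy_le i m (env x)⟩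

theorem exists_overwrite (hg : Computes env (m + 1) g) (hm : ∀ x, env x (m + 1) = []) :
    ∃ p : LoopProgram A, (∀ x, p.run (env x) = update (env x) m (g x)) ∧
      PolyBounded (fun x => sizeBelow (m + 1) (env x)) fun x => p.cost (env x) := by
  have hlen := hg.polyBounded_length hm
  have hold := (PolyBounded.refl _).of_le fun x => length_le_sizeBelow (Nat.lt_succ_self m) (env x)
  obtain ⟨p, hp, hcost⟩ := hg
  refine ⟨p ;; clear m ;; move (m + 1) m, fun x => ?_, ?_⟩
  · simp only [run, run_clear, run_move _ (Nat.succ_ne_self m), hp]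
    simp [update_comm (Nat.succ_ne_self m), hm]
  · have hclear := (hold.mul (.const _ 3)).add (.const _ 2)
    have hmove := (hlen.mul (.const _ 3)).add (.const _ 2)
    refine (hcost.add (hclear.add hmove)).of_le fun x => ?_
    simp only [cost, run_clear, hp]
    gcongr
    · simpa using cost_clear_le m (update (env x) (m + 1) (g x))
    · simpa using cost_move_le (m + 1) m (update (update (env x) (m + 1) (g x)) m [])

theorem trans (hf : Computes env m f)
    (hg : Computes (fun x => update (env x) m (f x)) (m + 1) g)
    (hm : ∀ x i, m ≤ i → env x i = []) : Computes env m g := by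
  have hlen := hf.polyBounded_length fun x => hm x m le_rfl
  obtain ⟨p, hp, hpcost⟩ := hf
  obtain ⟨q, hq, hqcost⟩ := hg.exists_overwrite fun x => by simp [hm x (m + 1) (Nat.le_succ m)]
  simp only [sizeBelow_update] at hqcost
  exact ⟨p ;; q, fun x => by simp only [run, hp, hq, update_idem],
    (hpcost.add (hqcost.trans ((PolyBounded.refl _).add hlen))).of_le fun x => by
      simp only [cost, hp, le_refl]⟩

/-- The loop maintains that the register `m` holds a suffix of `l x`, and `m + 1` the value of `F x`
at that suffix. -/
theorem forEach [Finite A] {l : X → List A} {F : X → List A → List A}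
    (hstep : ∀ a, Computes
      (fun q : X × List A => update (update (env q.1) m q.2) (m + 1) (F q.1 q.2)) (m + 2)
      fun q => F q.1 (a :: q.2))
    (hbase : Computes (fun x => update (env x) m (l x)) (m + 1) fun x => F x [])
    (hF : PolyBounded (fun q : X × List A => sizeBelow m (env q.1) + q.2.length)
      fun q => (F q.1 q.2).length)
    (hm : ∀ x i, m ≤ i → env x i = []) :
    Computes (fun x => update (env x) m (l x)) (m + 1) fun x => F x (l x) := by
  have := Fintype.ofFinite A
  obtain ⟨p, hp, hpcost⟩ := hbase
  choose q hq hqcost using fun a => (hstep a).exists_overwrite fun x => by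
    simp [hm x.1 (m + 2) (by omega), show m + 1 + 1 ≠ m by omega]
  simp only [sizeBelow_update] at hqcost hpcost
  let state (x : X) (t : List A) := update (update (env x) m t) (m + 1) (F x t)
  let body (a : A) := q a ;; push m a
  have hinit : ∀ x, update (update (update (env x) m (l x)) (m + 1) (F x [])) m [] = state x [] :=
    fun x => by simp [state, update_comm (Nat.succ_ne_self m)]
  have hbody : ∀ x a t, (body a).run (state x t) = state x (a :: t) := fun x a t => by
    simp [body, state, run, hq (a := a) (x := (x, t)), update_comm (Nat.succ_ne_self m)]
  have hself : ∀ x, update (update (env x) m (l x)) (m + 1) (F x []) m = l x := fun x => by simp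
  obtain ⟨P, hP⟩ : PolyBounded (fun x : X × List A => sizeBelow m (env x.1) + x.2.length)
      fun x => ∑ a, (body a).cost (state x.1 x.2) :=
    .sum fun a _ => (((hqcost a).trans ((PolyBounded.refl _).add hF)).add (.const _ 1)).of_le
      fun x => le_rfl
  have hcost : ∀ x a t, a :: t <:+ l x →
      (body a).cost (state x t) ≤ P.eval (sizeBelow m (env x) + (l x).length) := fun x a t ht =>
    (single_le_sum (f := fun a => (body a).cost (state x t)) (fun _ _ => Nat.zero_le _)
      (mem_univ a)).trans ((hP (x, t)).trans (monotone_polynomial_eval P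
        (Nat.add_le_add_left ((List.suffix_cons a t).trans ht).length_le _)))
  refine ⟨p ;; .forEach m body, fun x => ?_, ?_⟩
  · rw [run, hp, run_forEach_eq (hinit x) (hbody x), hself]
  · have hlength := (PolyBounded.refl fun x => sizeBelow m (env x) + (l x).length).of_le
      fun x => Nat.le_add_left (l x).length _
    simp only [sizeBelow_update, cost, hp]
    refine (hpcost.add ((hlength.mul (.add ⟨P, fun x => le_rfl⟩ (.const _ 2))).add
      (.const _ 2))).of_le fun x => Nat.add_le_add_left ?_ _
    simpa only [cost, hself] using cost_forEach_le_of_run_eq (hinit x) (hbody x)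
      fun a t ht => hcost x a t ((hself x).symm ▸ ht)

end Computes

end LoopProgram

/-- The type of values that are stored in one register, as a string over `A`. -/
class Word (A : Type) (β : Type) where
  /-- The string that stores a value. -/
  toList : β → List A

instance (A : Type) : Word A (List A) := ⟨id⟩

/-- Natural numbers are stored in unary, so that `PolyTime` means polynomial in the values of
numerical arguments. -/
instance (A : Type) [Inhabited A] : Word A ℕ := ⟨fun n => List.replicate n default⟩

/-- The type of values that are stored in finitely many registers, as strings over `A`. -/
class Storable (A : Type) (α : Type) where
  /-- The strings that store a value. -/
  components : List (α → List A)

instance {A β : Type} [Word A β] : Storable A β := ⟨[Word.toList]⟩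

instance {A α β : Type} [Storable A α] [Storable A β] : Storable A (α × β) :=
  ⟨Storable.components.map (· ∘ Prod.fst) ++ Storable.components.map (· ∘ Prod.snd)⟩

/-- The total length of the strings that store a value. -/
def storageSize (A : Type) {α : Type} [Storable A α] (x : α) : ℕ :=
  ((Storable.components (A := A)).map fun c : α → List A => (c x).length).sum

section

variable {A α β : Type}

@[simp] theorem toList_list (l : List A) : Word.toList l = l := rfl

@[simp] theorem length_toList_nat [Inhabited A] (n : ℕ) :
    (Word.toList (A := A) n).length = n :=
  List.length_replicate

@[simp] theorem storageSize_word [Word A β] (y : β) :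
    storageSize A y = (Word.toList (A := A) y).length := by
  simp [storageSize, Storable.components]

@[simp] theorem storageSize_prod [Storable A α] [Storable A β] (p : α × β) :
    storageSize A p = storageSize A p.1 + storageSize A p.2 := by
  simp [storageSize, Storable.components, comp_def]

end

open LoopProgram

/-- The registers below `m` store the value `e x`, and all others are empty. -/
structure StoredBelow {A X α : Type} [Storable A α] (env : X → ℕ → List A) (m : ℕ) (e : X → α) :
    Prop where
  eq_nil : ∀ x i, m ≤ i → env x i = []
  exists_register : ∀ c ∈ Storable.components (A := A) (α := α), ∃ i < m, ∀ x, env x i = c (e x)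

namespace StoredBelow

variable {A X α β : Type} [Storable A α] {env : X → ℕ → List A} {m : ℕ} {e : X → α}

theorem update (h : StoredBelow env m e) (w : X → List A) :
    StoredBelow (fun x => update (env x) m (w x)) (m + 1) e where
  eq_nil x i hi := by rw [update_of_ne (by omega), h.eq_nil x i (by omega)]
  exists_register c hc := by
    obtain ⟨i, hi, hic⟩ := h.exists_register c hc
    exact ⟨i, by omega, fun x => by rw [update_of_ne hi.ne, hic]⟩

theorem update_toList [Word A β] (h : StoredBelow env m e) (f : X → β) :
    StoredBelow (fun x => Function.update (env x) m (Word.toList (f x))) (m + 1) f where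
  eq_nil := (h.update _).eq_nil
  exists_register c hc := by
    obtain rfl := List.mem_singleton.mp hc
    exact ⟨m, m.lt_succ_self, fun x => update_self ..⟩

theorem comp {Y : Type} (h : StoredBelow env m e) (φ : Y → X) :
    StoredBelow (fun y => env (φ y)) m fun y => e (φ y) where
  eq_nil y := h.eq_nil (φ y)
  exists_register c hc := (h.exists_register c hc).imp fun _ hi => ⟨hi.1, fun y => hi.2 (φ y)⟩

theorem storageSize_le (h : StoredBelow env m e) (x : X) :
    storageSize A (e x) ≤ (Storable.components (A := A) (α := α)).length * sizeBelow m (env x) := by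
  refine (List.sum_le_card_nsmul _ (sizeBelow m (env x)) ?_).trans_eq (by simp)
  simp only [List.mem_map]
  rintro _ ⟨c, hc, rfl⟩
  obtain ⟨i, hi, hic⟩ := h.exists_register c hc
  exact hic x ▸ length_le_sizeBelow hi (env x)

variable [Storable A β]

theorem prodMk {e' : X → β} (h : StoredBelow env m e) (h' : StoredBelow env m e') :
    StoredBelow env m fun x => (e x, e' x) where
  eq_nil := h.eq_nil
  exists_register c hc := by
    rcases List.mem_append.mp hc with hc | hc <;> obtain ⟨c, hc', rfl⟩ := List.mem_map.mp hc
    exacts [h.exists_register c hc', h'.exists_register c hc']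

theorem fst {e : X → α × β} (h : StoredBelow env m e) : StoredBelow env m fun x => (e x).1 where
  eq_nil := h.eq_nil
  exists_register c hc :=
    h.exists_register (c ∘ Prod.fst) (List.mem_append_left _ (List.mem_map_of_mem hc))

theorem snd {e : X → α × β} (h : StoredBelow env m e) : StoredBelow env m fun x => (e x).2 where
  eq_nil := h.eq_nil
  exists_register c hc :=
    h.exists_register (c ∘ Prod.snd) (List.mem_append_right _ (List.mem_map_of_mem hc))

end StoredBelow

/-- `f` is computed by a program in polynomial time, component by component, wherever its argument
is stored. -/
def PolyTime (A : Type) {α β : Type} [Storable A α] [Storable A β] (f : α → β) : Prop :=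
  ∀ c ∈ Storable.components (A := A), ∀ ⦃X : Type⦄ ⦃env : X → ℕ → List A⦄ ⦃m : ℕ⦄ ⦃e : X → α⦄,
    StoredBelow env m e → Computes env m fun x => c (f (e x))

theorem polyTime_word_iff {A α δ : Type} [Storable A α] [Word A δ] {f : α → δ} :
    PolyTime A f ↔ ∀ ⦃X : Type⦄ ⦃env : X → ℕ → List A⦄ ⦃m : ℕ⦄ ⦃e : X → α⦄, StoredBelow env m e →
      Computes env m fun x => Word.toList (f (e x)) := by
  simp only [PolyTime, Storable.components, List.mem_singleton, forall_eq]

theorem StoredBelow.computes_of_stored {A X α : Type} [Storable A α] {env : X → ℕ → List A} {m : ℕ}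
    {e : X → α} {g : X → List A} (h : StoredBelow env m e) {ws : List (X → List A)}
    (hws : ∀ w ∈ ws, ∀ ⦃env : X → ℕ → List A⦄ ⦃m⦄, StoredBelow env m e → Computes env m w)
    (hg : ∀ ⦃env : X → ℕ → List A⦄ ⦃m⦄, StoredBelow env m e →
      (∀ w ∈ ws, ∃ i < m, ∀ x, env x i = w x) → Computes env m g) : Computes env m g := by
  induction ws with
  | nil => exact hg h (by simp)
  | cons w ws ih =>
    rw [List.forall_mem_cons] at hws
    refine ih hws.2 fun env m henv hstored => (hws.1 henv).trans (hg (henv.update w) ?_) henv.eq_nil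
    refine List.forall_mem_cons.mpr ⟨⟨m, m.lt_succ_self, fun x => by simp⟩, fun v hv => ?_⟩
    obtain ⟨i, hi, hiv⟩ := hstored v hv
    exact ⟨i, by omega, fun x => by rw [update_of_ne hi.ne, hiv]⟩

namespace PolyTime

variable {A α β γ δ : Type} [Storable A α] [Storable A β] [Storable A γ]

protected theorem id : PolyTime A fun x : α => x := fun c hc _ _ _ _ h => by
  obtain ⟨i, hi, hic⟩ := h.exists_register c hc
  simpa only [← hic] using Computes.register hi fun x => h.eq_nil x _ le_rfl

theorem comp {g : β → γ} {f : α → β} (hg : PolyTime A g) (hf : PolyTime A f) :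
    PolyTime A fun x => g (f x) := fun c hc _ _ _ e h =>
  h.computes_of_stored (ws := Storable.components.map fun c x => c (f (e x)))
    (List.forall_mem_map.mpr fun c hc _ _ henv => hf c hc henv)
    fun _ _ henv hstored => hg c hc ⟨henv.eq_nil, fun _ hc => hstored _ (List.mem_map_of_mem hc)⟩

theorem fst : PolyTime A (Prod.fst : α × β → α) := fun c hc _ _ _ _ h => PolyTime.id c hc h.fst

theorem snd : PolyTime A (Prod.snd : α × β → β) := fun c hc _ _ _ _ h => PolyTime.id c hc h.snd

theorem prodMk {f : α → β} {g : α → γ} (hf : PolyTime A f) (hg : PolyTime A g) :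
    PolyTime A fun x => (f x, g x) := fun c hc => by
  rcases List.mem_append.mp hc with hc | hc <;> obtain ⟨c, hc', rfl⟩ := List.mem_map.mp hc
  exacts [hf c hc', hg c hc']

theorem polyBounded_length [Word A δ] {f : α → δ} (hf : PolyTime A f) :
    PolyBounded (storageSize A) fun x => (Word.toList (A := A) (f x)).length := by
  let env (x : α) (i : ℕ) : List A := (Storable.components.map fun c : α → List A => c x).getD i []
  have henv : StoredBelow env (Storable.components (A := A) (α := α)).length fun x => x :=
    ⟨fun x i hi => List.getD_eq_default _ _ (by simpa using hi), fun c hc => by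
      obtain ⟨i, hi, rfl⟩ := List.mem_iff_getElem.mp hc
      exact ⟨i, hi, fun x => by simp [env, hi]⟩⟩
  have hsize : ∀ x, sizeBelow (Storable.components (A := A) (α := α)).length (env x) =
      storageSize A x := fun x => by
    simp only [sizeBelow, sum_range, storageSize, env]
    rw [← Fin.sum_univ_fun_getElem]
    simp
  simpa only [hsize] using (polyTime_word_iff.mp hf henv).polyBounded_length fun x =>
    henv.eq_nil x _ le_rfl

theorem listRec [Finite A] [Word A δ] {F : α → List A → δ} {base : α → δ}
    {step : A → α × List A × δ → δ} (hbase : PolyTime A base) (hstep : ∀ a, PolyTime A (step a))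
    (hnil : ∀ x, F x [] = base x) (hcons : ∀ x a l, F x (a :: l) = step a (x, l, F x l))
    (hF : PolyBounded (storageSize A) fun p : α × List A =>
      (Word.toList (A := A) (F p.1 p.2)).length)
    {f : α → List A} (hf : PolyTime A f) : PolyTime A fun x => F x (f x) := by
  refine polyTime_word_iff.mpr fun X env m e h => ?_
  refine (polyTime_word_iff.mp hf h).trans (.forEach (F := fun x l => Word.toList (F (e x) l))
    (fun a => ?_) ?_ ?_ h.eq_nil) h.eq_nil
  · simp only [hcons]
    have hx := h.comp (Prod.fst : X × List A → X)
    have hl := hx.update_toList (Prod.snd : X × List A → List A)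
    exact polyTime_word_iff.mp (hstep a) (((hx.update _).update _).prodMk ((hl.update _).prodMk
      ((hx.update _).update_toList fun q => F (e q.1) q.2)))
  · simp only [hnil]
    exact polyTime_word_iff.mp hbase (h.update _)
  · refine (hF.comp fun q : X × List A => (e q.1, q.2)).trans ?_
    refine (((PolyBounded.const _ (Storable.components (A := A) (α := α)).length).mul
      (.refl _)).add (.refl _)).of_le fun q => ?_
    rw [storageSize_prod, storageSize_word, toList_list]
    exact add_le_add ((h.storageSize_le q.1).trans
      (Nat.mul_le_mul_left _ (Nat.le_add_right _ _))) (Nat.le_add_left _ _)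

theorem cons {f : α → List A} (a : A) (hf : PolyTime A f) : PolyTime A fun x => a :: f x :=
  polyTime_word_iff.mpr fun _ _ _ _ h => (polyTime_word_iff.mp hf h).cons a

theorem nil : PolyTime A fun _ : α => ([] : List A) :=
  polyTime_word_iff.mpr fun _ _ _ _ h => .nil fun x => h.eq_nil x _ le_rfl

section Nat

variable [Inhabited A] {f g : α → ℕ}

theorem polyBounded (hf : PolyTime A f) : PolyBounded (storageSize A) f := by
  simpa using hf.polyBounded_length

theorem zero : PolyTime A fun _ : α => (0 : ℕ) :=
  polyTime_word_iff.mpr (polyTime_word_iff.mp nil)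

theorem succ (hf : PolyTime A f) : PolyTime A fun x => f x + 1 :=
  polyTime_word_iff.mpr fun _ _ _ _ h => (polyTime_word_iff.mp hf h).cons default

theorem const (n : ℕ) : PolyTime A fun _ : α => n := by
  induction n with
  | zero => exact zero
  | succ n ih => exact ih.succ

variable [Finite A]

theorem length {f : α → List A} (hf : PolyTime A f) : PolyTime A fun x => (f x).length :=
  listRec (F := fun _ l => l.length) (step := fun _ p => p.2.2 + 1) zero
    (fun _ => (snd.comp snd).succ) (fun _ => rfl) (fun _ _ _ => rfl)
    ((PolyBounded.refl _).of_le fun p => by simp) hf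

theorem natRec [Word A δ] {F : α → ℕ → δ} {base : α → δ} {step : α × ℕ × δ → δ}
    (hbase : PolyTime A base) (hstep : PolyTime A step) (hzero : ∀ x, F x 0 = base x)
    (hsucc : ∀ x n, F x (n + 1) = step (x, n, F x n))
    (hF : PolyBounded (storageSize A) fun p : α × ℕ => (Word.toList (A := A) (F p.1 p.2)).length)
    (hf : PolyTime A f) : PolyTime A fun x => F x (f x) := by
  have hunary : PolyTime A fun x => List.replicate (f x) (default : A) :=
    polyTime_word_iff.mpr (polyTime_word_iff.mp hf)
  simpa only [List.length_replicate] using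
    listRec (F := fun x l => F x l.length) (step := fun _ p => step (p.1, p.2.1.length, p.2.2))
      hbase (fun _ => hstep.comp (fst.prodMk ((length (fst.comp snd)).prodMk (snd.comp snd)))) hzero
      (fun x _ l => hsucc x l.length)
      ((hF.comp fun p : α × List A => (p.1, p.2.length)).trans
        ((PolyBounded.refl _).of_le fun p => by simp)) hunary

theorem pred (hf : PolyTime A f) : PolyTime A fun x => f x - 1 :=
  natRec (F := fun _ n => n - 1) (step := fun p => p.2.1) zero (fst.comp snd) (fun _ => rfl)
    (fun _ _ => rfl) ((PolyBounded.refl _).of_le fun p => by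
      simpa using (Nat.sub_le _ _).trans (Nat.le_add_left _ _)) hf

theorem sub (hf : PolyTime A f) (hg : PolyTime A g) : PolyTime A fun x => f x - g x :=
  natRec (F := fun x n => f x - n) (step := fun p => p.2.2 - 1) hf (snd.comp snd).pred
    (fun _ => rfl) (fun _ _ => rfl)
    ((hf.comp fst).polyBounded.of_le fun p => by simp) hg

theorem add (hf : PolyTime A f) (hg : PolyTime A g) : PolyTime A fun x => f x + g x :=
  natRec (F := fun x n => f x + n) (step := fun p => p.2.2 + 1) hf (snd.comp snd).succ
    (fun _ => rfl) (fun _ _ => rfl)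
    (((hf.comp fst).polyBounded.add (.refl _)).of_le fun p => by simp) hg

protected theorem min (hf : PolyTime A f) (hg : PolyTime A g) :
    PolyTime A fun x => min (f x) (g x) := by
  simpa only [tsub_tsub_eq_min] using hf.sub (hf.sub hg)

protected theorem sum_range {g : α × ℕ → ℕ} (hg : PolyTime A g) (hf : PolyTime A f) :
    PolyTime A fun x => ∑ i ∈ range (f x), g (x, i) := by
  obtain ⟨P, hP⟩ := hg.polyBounded
  refine natRec (F := fun x n => ∑ i ∈ range n, g (x, i)) (step := fun p => p.2.2 + g (p.1, p.2.1))
    zero ((snd.comp snd).add (hg.comp (fst.prodMk (fst.comp snd)))) (fun x => sum_range_zero _)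
    (fun x n => sum_range_succ _ n)
    (((PolyBounded.refl _).mul ⟨P, fun x => le_rfl⟩).of_le fun p => ?_) hf
  have hterm : ∀ i ∈ range p.2, g (p.1, i) ≤ P.eval (storageSize A p) := fun i hi =>
    (hP _).trans (monotone_polynomial_eval P (by simpa using (mem_range.mp hi).le))
  rw [length_toList_nat]
  refine (sum_le_card_nsmul _ _ _ hterm).trans ?_
  simp only [card_range, smul_eq_mul]
  gcongr
  simp

theorem mul (hf : PolyTime A f) (hg : PolyTime A g) : PolyTime A fun x => f x * g x := by
  simpa using PolyTime.sum_range (hg.comp fst) hf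

theorem ite_le (hf : PolyTime A f) (hg : PolyTime A g) :
    PolyTime A fun x => if f x ≤ g x then 1 else 0 := by
  convert (const 1).sub (hf.sub hg) using 2 with x
  split_ifs <;> omega

theorem ite_eq (hf : PolyTime A f) (hg : PolyTime A g) :
    PolyTime A fun x => if f x = g x then 1 else 0 := by
  convert (hf.ite_le hg).mul (hg.ite_le hf) using 2 with x
  split_ifs <;> omega

end Nat

end PolyTime

/-- The sum of `g a l'` over the ways to write a list as `⋯ ++ a :: l'`. -/
def suffixSum {A : Type} (g : A → List A → ℕ) : List A → ℕ
  | [] => 0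
  | a :: l => g a l + suffixSum g l

theorem suffixSum_le {A : Type} {g : A → List A → ℕ} {l : List A} {B : ℕ}
    (h : ∀ a l', a :: l' <:+ l → g a l' ≤ B) : suffixSum g l ≤ l.length * B := by
  induction l with
  | nil => exact Nat.zero_le _
  | cons a l ih =>
    have := h a l List.suffix_rfl
    have := ih fun a' l' hl' => h a' l' (hl'.trans (List.suffix_cons a l))
    simp only [suffixSum, List.length_cons, add_one_mul]
    omega

namespace PolyTime

variable {A α : Type} [Storable A α] [Finite A] {f : α → List A}

theorem takeWhile (p : A → Bool) (hf : PolyTime A f) : PolyTime A fun x => (f x).takeWhile p :=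
  listRec (F := fun _ l => l.takeWhile p) (step := fun a q => if p a then a :: q.2.2 else []) nil
    (fun a => by by_cases h : p a <;> simp only [h]; exacts [cons a (snd.comp snd), nil])
    (fun _ => rfl) (fun _ _ _ => List.takeWhile_cons)
    ((PolyBounded.refl _).of_le fun q => by
      simpa using (List.takeWhile_sublist p).length_le.trans (Nat.le_add_left _ _)) hf

theorem dropWhile (p : A → Bool) (hf : PolyTime A f) : PolyTime A fun x => (f x).dropWhile p :=
  listRec (F := fun _ l => l.dropWhile p) (step := fun a q => if p a then q.2.2 else a :: q.2.1) nil
    (fun a => by by_cases h : p a <;> simp only [h]; exacts [snd.comp snd, cons a (fst.comp snd)])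
    (fun _ => rfl) (fun _ _ _ => List.dropWhile_cons)
    ((PolyBounded.refl _).of_le fun q => by
      simpa using (List.dropWhile_sublist p).length_le.trans (Nat.le_add_left _ _)) hf

theorem tail (hf : PolyTime A f) : PolyTime A fun x => (f x).tail :=
  listRec (F := fun _ l => l.tail) (step := fun _ q => q.2.1) nil (fun _ => fst.comp snd)
    (fun _ => rfl) (fun _ _ _ => rfl) ((PolyBounded.refl _).of_le fun q => by
      simpa using (Nat.sub_le _ _).trans (Nat.le_add_left _ _)) hf

protected theorem suffixSum [Inhabited A] {g : A → α × List A → ℕ} (hg : ∀ a, PolyTime A (g a))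
    (hf : PolyTime A f) : PolyTime A fun x => suffixSum (fun a l => g a (x, l)) (f x) := by
  have := Fintype.ofFinite A
  choose P hP using fun a => (hg a).polyBounded
  refine listRec (F := fun x l => _root_.suffixSum (fun a l => g a (x, l)) l)
    (step := fun a q => g a (q.1, q.2.1) + q.2.2) zero
    (fun a => ((hg a).comp (fst.prodMk (fst.comp snd))).add (snd.comp snd)) (fun _ => rfl)
    (fun _ _ _ => rfl)
    (((PolyBounded.refl _).mul ⟨∑ a, P a, fun x => le_rfl⟩).of_le fun q => ?_) hf
  obtain ⟨x, l⟩ := q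
  rw [length_toList_nat]
  refine (suffixSum_le (B := (∑ a, P a).eval (storageSize A (x, l))) fun a l' hl' => ?_).trans
    (by gcongr; simp)
  have hle : storageSize A (x, l') ≤ storageSize A (x, l) := by
    simpa using ((List.suffix_cons a l').trans hl').length_le
  rw [Polynomial.eval_finsetSum]
  exact ((hP a _).trans (monotone_polynomial_eval _ hle)).trans
    (single_le_sum (f := fun a => (P a).eval (storageSize A (x, l))) (fun _ _ => Nat.zero_le _)
      (mem_univ a))

end PolyTime

open Classical in
theorem decidableInPolyTime_of_polyTime {A I : Type} [Finite A] [Inhabited A] {enc : I → List A}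
    {L : I → Prop} {f : List A → ℕ} (hf : PolyTime A f) (h : ∀ x, f (enc x) = 0 ↔ L x) :
    WAV.DecidableInPolyTime enc L := by
  have henv : StoredBelow (fun w : List A => update (fun _ => []) 0 w) 1 fun w => w :=
    ⟨fun w i hi => update_of_ne (by omega) .., fun c hc =>
      ⟨0, one_pos, fun w => by obtain rfl := List.mem_singleton.mp hc; simp⟩⟩
  obtain ⟨p, hp, P, hP⟩ := polyTime_word_iff.mp ((PolyTime.const 1).sub hf) henv
  simp only [sizeBelow, range_one, sum_singleton, update_self] at hP
  refine decidableInPolyTime_of_run (p ;; clear 0) (P + (Polynomial.X * 3 + 2)) (fun x => ?_)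
    fun x => ?_
  · have houtput : 1 - f (enc x) = (decide (L x)).toNat := by
      by_cases hx : L x
      · simp [hx, (h x).mpr hx]
      · simp [hx, Nat.one_le_iff_ne_zero.mpr (mt (h x).mp hx)]
    simp only [run, hp, run_clear, houtput]
    rw [update_comm one_ne_zero, update_idem, update_eq_self_iff.mpr rfl]
    rfl
  · simp only [cost, hp, Polynomial.eval_add, Polynomial.eval_mul, Polynomial.eval_X,
      Polynomial.eval_ofNat]
    exact add_le_add (hP _) ((cost_clear_le 0 _).trans_eq (by simp))

end PolynomialTime

namespace WAV

open Finset

variable {ℓ k m b d t : ℕ}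

section Score

theorem voteScore_apply (a : Fin ℓ → ℕ) (v : TopRanking ℓ m) (j : Fin ℓ) :
    voteScore a v (v j) = a j := by
  simp [voteScore]

theorem voteScore_eq_zero (a : Fin ℓ → ℕ) {v : TopRanking ℓ m} {x : Fin m} (h : ∀ j, v j ≠ x) :
    voteScore a v x = 0 := by
  simp [voteScore, h]

theorem voteScore_mono {a a' : Fin ℓ → ℕ} (h : a ≤ a') (v : TopRanking ℓ m) :
    voteScore a v ≤ voteScore a' v :=
  fun _ => sum_le_sum fun j _ => by split_ifs; exacts [h j, le_rfl]

theorem voteScore_const_le (A : ℕ) (v : TopRanking ℓ m) (x : Fin m) :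
    voteScore (fun _ => A) v x ≤ A := by
  by_cases h : ∃ j, v j = x
  · obtain ⟨j, rfl⟩ := h
    exact (voteScore_apply _ v j).le
  · exact (voteScore_eq_zero _ (not_exists.mp h)).trans_le A.zero_le

theorem sum_voteScore (a : Fin ℓ → ℕ) (v : TopRanking ℓ m) : ∑ x, voteScore a v x = ∑ j, a j := by
  simp only [voteScore]
  rw [sum_comm]
  simp

theorem score_append (a : Fin ℓ → ℕ) (P Q : List (TopRanking ℓ m)) (x : Fin m) :
    score a (P ++ Q) x = score a P x + score a Q x := by
  simp [score]

theorem score_cons (a : Fin ℓ → ℕ) (v : TopRanking ℓ m) (P : List (TopRanking ℓ m)) (x : Fin m) :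
    score a (v :: P) x = voteScore a v x + score a P x := by
  simp [score]

theorem score_mono {a a' : Fin ℓ → ℕ} (h : a ≤ a') (P : List (TopRanking ℓ m)) :
    score a P ≤ score a' P :=
  fun x => List.sum_le_sum fun v _ => voteScore_mono h v x

theorem score_const_mul (A : ℕ) (P : List (TopRanking ℓ m)) (x : Fin m) :
    score (fun _ => A) P x = A * score (fun _ => 1) P x := by
  rw [score, score, ← List.sum_map_mul_left]
  simp only [voteScore, mul_sum, mul_ite, mul_one, mul_zero]

theorem score_const_le (A : ℕ) (P : List (TopRanking ℓ m)) (x : Fin m) :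
    score (fun _ => A) P x ≤ P.length * A := by
  simpa [score] using List.sum_le_card_nsmul (P.map fun v => voteScore (fun _ => A) v x) A
    (by simpa using fun v _ => voteScore_const_le A v x)

theorem sum_score (a : Fin ℓ → ℕ) (P : List (TopRanking ℓ m)) :
    ∑ x, score a P x = P.length * ∑ j, a j := by
  induction P with
  | nil => simp [score]
  | cons v P ih =>
    simp only [score_cons, sum_add_distrib, ih, sum_voteScore, List.length_cons]
    ring

/-- The handicap of the candidate `c` against `x` in a comparison of scores, due to ties. -/
def tieBonus (prio : Fin m ≃ Fin m) (c x : Fin m) : ℕ :=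
  if prio.symm x < prio.symm c then 1 else 0

theorem tieBonus_self (prio : Fin m ≃ Fin m) (c : Fin m) : tieBonus prio c c = 0 := by
  simp [tieBonus]

theorem tieBonus_le_one (prio : Fin m ≃ Fin m) (c x : Fin m) : tieBonus prio c x ≤ 1 := by
  unfold tieBonus
  split_ifs <;> simp

theorem isWinner_iff (a : Fin ℓ → ℕ) (prio : Fin m ≃ Fin m) (P : List (TopRanking ℓ m))
    (c : Fin m) :
    IsWinner a prio P c ↔ ∀ x, score a P x + tieBonus prio c x ≤ score a P c := by
  rw [IsWinner, ← forall_and]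
  refine forall_congr' fun x => ?_
  unfold tieBonus
  split_ifs with h
  · simp only [h.not_ge, imp_false]
    omega
  · simp only [not_lt.mp h, implies_true, and_true, add_zero]

end Score

section Votes

theorem exists_card_eq_of_sum_eq {ι : Type} [Fintype ι] {n : ι → ℕ} (hn : ∀ x, n x ≤ t + 1)
    (hs : ∑ x, n x = (t + 1) * k) :
    ∃ U : Finset ι, #U = k ∧ (∀ x ∈ U, 0 < n x) ∧ ∀ x ∉ U, n x ≤ t := by
  have hfull : #{x | n x = t + 1} ≤ k := by
    refine Nat.le_of_mul_le_mul_left ?_ t.succ_pos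
    rw [← hs, mul_comm, ← smul_eq_mul, ← sum_const]
    calc ∑ x with n x = t + 1, (t + 1) = ∑ x with n x = t + 1, n x :=
          sum_congr rfl fun x hx => (mem_filter.mp hx).2.symm
      _ ≤ ∑ x, n x := sum_le_sum_of_subset (filter_subset _ _)
  have hpos : k ≤ #{x | 0 < n x} := by
    refine Nat.le_of_mul_le_mul_left ?_ t.succ_pos
    rw [← hs, mul_comm, ← smul_eq_mul, ← sum_const, sum_filter]
    exact sum_le_sum fun x _ => by
      have := hn x
      split_ifs <;> omega
  obtain ⟨U, hfullU, hUpos, hU⟩ :=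
    exists_subsuperset_card_eq (monotone_filter_right univ fun x _ hx => by omega) hfull hpos
  refine ⟨U, hU, fun x hx => (mem_filter.mp (hUpos hx)).2, fun x hx => ?_⟩
  have : n x ≠ t + 1 := fun h => hx (hfullU (mem_filter.mpr ⟨mem_univ x, h⟩))
  have := hn x
  omega

theorem exists_voteScore_eq {a : Fin (k + 1) → ℕ} (hb : ∀ j : Fin k, a j.succ = b) {c : Fin m}
    {U : Finset (Fin m)} (hU : #U = k) (hc : c ∉ U) :
    ∃ v : TopRanking (k + 1) m, voteScore a v c = a 0 ∧
      ∀ x, x ≠ c → voteScore a v x = if x ∈ U then b else 0 := by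
  let e : Fin k ≃ U := (U.equivFinOfCardEq hU).symm
  let v : TopRanking (k + 1) m := ⟨Fin.cons c fun j => (e j : Fin m), Fin.cons_injective_iff.mpr
    ⟨by rintro ⟨j, hj⟩; exact hc (hj ▸ (e j).2), Subtype.val_injective.comp e.injective⟩⟩
  refine ⟨v, voteScore_apply a v 0, fun x hx => ?_⟩
  split_ifs with hxU
  · have hv : v (e.symm ⟨x, hxU⟩).succ = x := by simp [v]
    rw [← hb, ← voteScore_apply a v, hv]
  · exact voteScore_eq_zero a (Fin.cases hx.symm fun j hj => hxU (hj ▸ (e j).2))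

theorem exists_score_eq {a : Fin (k + 1) → ℕ} (hb : ∀ j : Fin k, a j.succ = b) (c : Fin m)
    {n : Fin m → ℕ} (hn : ∀ x, n x ≤ t) (hc : n c = 0) (hs : ∑ x, n x = t * k) :
    ∃ P : List (TopRanking (k + 1) m), P.length = t ∧ score a P c = t * a 0 ∧
      ∀ x, x ≠ c → score a P x = n x * b := by
  induction t generalizing n with
  | zero => exact ⟨[], rfl, by simp [score], fun x _ => by simp [score, Nat.le_zero.mp (hn x)]⟩
  | succ t ih =>
    obtain ⟨U, hU, hpos, hle⟩ := exists_card_eq_of_sum_eq hn hs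
    have hcU : c ∉ U := fun h => (hpos c h).ne' hc
    have hn' : ∀ x, n x = (n x - if x ∈ U then 1 else 0) + if x ∈ U then 1 else 0 := fun x => by
      split_ifs with h
      · exact (Nat.sub_add_cancel (hpos x h)).symm
      · rfl
    obtain ⟨P, hP, hPc, hPx⟩ := ih (n := fun x => n x - if x ∈ U then 1 else 0)
      (fun x => by
        have := hn x
        split_ifs with h
        · omega
        · exact hle x h)
      (by simp [hc])
      (by
        rw [sum_congr rfl fun x _ => hn' x, sum_add_distrib] at hs
        simp only [sum_ite_mem, univ_inter, sum_const, smul_eq_mul, mul_one, hU] at hs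
        linarith)
    obtain ⟨v, hvc, hvx⟩ := exists_voteScore_eq hb hU hcU
    refine ⟨v :: P, by rw [List.length_cons, hP], by rw [score_cons, hvc, hPc]; ring,
      fun x hx => ?_⟩
    rw [score_cons, hvx x hx, hPx x hx]
    nth_rw 2 [hn' x]
    split_ifs <;> ring

theorem exists_le_sum_eq {ι : Type} [Fintype ι] {f : ι → ℕ} {s : ℕ} (h : s ≤ ∑ x, f x) :
    ∃ g : ι → ℕ, g ≤ f ∧ ∑ x, g x = s := by
  classical
  induction s with
  | zero => exact ⟨0, fun x => Nat.zero_le _, sum_const_zero⟩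
  | succ s ih =>
    obtain ⟨g, hg, hs⟩ := ih (by omega)
    obtain ⟨x, -, hx⟩ := exists_lt_of_sum_lt (hs.trans_lt h)
    refine ⟨g + Pi.single x 1, fun y => ?_, by simp [sum_add_distrib, hs]⟩
    by_cases hy : y = x
    · subst hy; simpa using hx
    · simpa [hy] using hg y

end Votes

section Feasible

/-- The number of the `t` absent votes in which a candidate can be ranked, with `b` points in each,
if ranking it in all of them would give it `e` points too many. For `1 ≤ u ≤ t`, it can be ranked in
`u` votes if and only if `e ≤ b * (t - u)`. -/
def capacity (b t e : ℕ) : ℕ := Nat.count (fun i => e ≤ b * i) t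

theorem capacity_zero_right (b t : ℕ) : capacity b t 0 = t :=
  Nat.count_iff_forall.mpr fun _ _ => Nat.zero_le _

theorem capacity_le (b t e : ℕ) : capacity b t e ≤ t := Nat.count_le _

theorem capacity_add {e : ℕ} (he : e ≤ b * t) (u : ℕ) :
    capacity b (t + u) e = capacity b t e + u := by
  rw [capacity, Nat.count_add, Nat.count_iff_forall.mpr fun i _ =>
    he.trans (Nat.mul_le_mul_left b (Nat.le_add_right t i)), capacity]

theorem le_capacity_iff {e u : ℕ} (he : e ≤ b * t) (hu : u ≤ t) :
    u ≤ capacity b t e ↔ b * u + e ≤ b * t := by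
  obtain ⟨r, rfl⟩ := Nat.exists_eq_add_of_le' hu
  rw [mul_add, add_comm (b * u), Nat.add_le_add_iff_right]
  refine ⟨fun h => ?_, fun h => by rw [capacity_add h]; exact Nat.le_add_left _ _⟩
  by_contra hlt
  have hbefore : Nat.count (fun i => e ≤ b * i) r = 0 := Nat.count_iff_forall_not.mpr
    fun i hi hle => hlt (hle.trans (Nat.mul_le_mul_left b hi.le))
  have hpos : 0 < u := Nat.pos_of_ne_zero fun hu => hlt (by simpa [hu] using he)
  rw [capacity, Nat.count_add, hbefore, zero_add] at h
  exact hlt (Nat.count_iff_forall.mp ((Nat.count_le _).antisymm h) 0 hpos)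

/-- The number of points by which `x`, with score `s x`, would beat the target `c` if `c` were
ranked first and `x` were ranked lower in all of `t` further votes, where the first position gives
`d` points more than the lower ones. -/
def excess (prio : Fin m ≃ Fin m) (c : Fin m) (s : Fin m → ℕ) (d t : ℕ) (x : Fin m) : ℕ :=
  s x + tieBonus prio c x - (s c + t * d)

/-- The numerical criterion for the target `c` to win with `t` absent votes, from the scores `s` in
the known votes. -/
def Feasible (prio : Fin m ≃ Fin m) (c : Fin m) (s : Fin m → ℕ) (ℓ b d t : ℕ) : Prop :=
  (∀ x, excess prio c s d t x ≤ b * t) ∧ t * ℓ ≤ ∑ x, capacity b t (excess prio c s d t x)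

variable {prio : Fin m ≃ Fin m} {c : Fin m} {s : Fin m → ℕ}

theorem excess_self : excess prio c s d t c = 0 := by
  simp [excess, tieBonus_self]

theorem excess_le (x : Fin m) : excess prio c s d t x ≤ s x + 1 :=
  (Nat.sub_le _ _).trans (Nat.add_le_add_left (tieBonus_le_one prio c x) _)

theorem excess_eq_of_le {N : ℕ} {x : Fin m} (hN : s x + 1 ≤ N) (ht : N ≤ t) :
    excess prio c s d t x = excess prio c s d N x := by
  rcases d.eq_zero_or_pos with rfl | hd
  · simp [excess]
  · have := tieBonus_le_one prio c x
    have := Nat.le_mul_of_pos_right t hd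
    have := Nat.le_mul_of_pos_right N hd
    unfold excess
    omega

theorem feasible_of_score_le {a : Fin (k + 1) → ℕ} (hb : ∀ j : Fin k, a j.succ = b)
    (hd : a 0 = b + d) {Q : List (TopRanking (k + 1) m)} (hQ : Q.length = t)
    (hw : ∀ x, s x + score a Q x + tieBonus prio c x ≤ s c + score a Q c) :
    Feasible prio c s (k + 1) b d t := by
  let n (x : Fin m) := score (fun _ => 1) Q x
  have hbounds : (∀ j, b ≤ a j) ∧ ∀ j, a j ≤ b + d := by
    simp only [Fin.forall_fin_succ, hb, hd]
    simp
  have hnt : ∀ x, n x ≤ t := fun x => by simpa [hQ] using score_const_le 1 Q x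
  have hn : ∀ x, b * n x + excess prio c s d t x ≤ b * t := fun x => by
    have hlower : b * n x ≤ score a Q x :=
      (score_const_mul b Q x).symm.trans_le (score_mono hbounds.1 Q x)
    have hupper : score a Q c ≤ t * (b + d) :=
      (score_mono hbounds.2 Q c).trans (hQ ▸ score_const_le (b + d) Q c)
    have := hw x
    have := Nat.mul_le_mul_left b (hnt x)
    rw [mul_add, mul_comm t b] at hupper
    unfold excess
    omega
  have hexcess : ∀ x, excess prio c s d t x ≤ b * t := fun x => (Nat.le_add_left _ _).trans (hn x)
  refine ⟨hexcess, ?_⟩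
  calc t * (k + 1) = ∑ x, n x := by simp [n, sum_score, hQ]
    _ ≤ ∑ x, capacity b t (excess prio c s d t x) :=
      sum_le_sum fun x _ => (le_capacity_iff (hexcess x) (hnt x)).mpr (hn x)

theorem Feasible.exists_score_le {a : Fin (k + 1) → ℕ} (hb : ∀ j : Fin k, a j.succ = b)
    (hd : a 0 = b + d) (h : Feasible prio c s (k + 1) b d t) :
    ∃ Q : List (TopRanking (k + 1) m), Q.length = t ∧
      ∀ x, s x + score a Q x + tieBonus prio c x ≤ s c + score a Q c := by
  obtain ⟨hexcess, hsum⟩ := h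
  let f := Function.update (fun x => capacity b t (excess prio c s d t x)) c 0
  have hf : t * k ≤ ∑ x, f x := by
    rw [← add_sum_erase univ _ (mem_univ c), excess_self, capacity_zero_right, mul_add_one] at hsum
    rw [sum_update_of_mem (mem_univ c), ← erase_eq]
    omega
  obtain ⟨n, hn, hns⟩ := exists_le_sum_eq hf
  have hnc : n c = 0 := Nat.le_zero.mp ((hn c).trans_eq (by simp [f]))
  have hnx : ∀ x, x ≠ c → n x ≤ capacity b t (excess prio c s d t x) := fun x hx =>
    (hn x).trans_eq (by simp [f, hx])
  have hnt : ∀ x, n x ≤ t := fun x => by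
    by_cases hx : x = c
    · simp [hx, hnc]
    · exact (hnx x hx).trans (capacity_le _ _ _)
  obtain ⟨Q, hQ, hQc, hQx⟩ := exists_score_eq hb c hnt hnc hns
  refine ⟨Q, hQ, fun x => ?_⟩
  by_cases hx : x = c
  · simp [hx, tieBonus_self]
  · have hfits := (le_capacity_iff (hexcess x) (hnt x)).mp (hnx x hx)
    have htop : t * (b + d) = b * t + t * d := by ring
    unfold excess at hfits
    rw [hQx x hx, hQc, hd, mul_comm (n x)]
    omega

theorem isYes_iff_feasible {a : Fin (k + 1) → ℕ} (hb : ∀ j : Fin k, a j.succ = b)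
    (hd : a 0 = b + d) (I : Instance (k + 1)) :
    IsYes a I ↔ Feasible I.prio I.target (score a I.known) (k + 1) b d I.t := by
  simp only [IsYes, isWinner_iff, score_append]
  exact ⟨fun ⟨_, hQ, hw⟩ => feasible_of_score_le hb hd hQ hw, fun h => h.exists_score_le hb hd⟩

theorem le_sum_capacity_add_iff {ι : Type} [Fintype ι] {e : ι → ℕ} {N : ℕ} (hN : 0 < N)
    (he : ∀ x, e x ≤ b * N) (hsum : ∑ x, e x ≤ N) (u : ℕ) :
    (N + u) * ℓ ≤ ∑ x, capacity b (N + u) (e x) ↔ N * ℓ ≤ ∑ x, capacity b N (e x) := by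
  have hadd : ∑ x, capacity b (N + u) (e x) = ∑ x, capacity b N (e x) + u * Fintype.card ι := by
    simp [capacity_add (he _), sum_add_distrib, mul_comm]
  have hupper : ∑ x, capacity b N (e x) ≤ N * Fintype.card ι :=
    (sum_le_card_nsmul _ _ _ fun x _ => capacity_le b N (e x)).trans_eq (mul_comm _ _)
  have hlower : N * Fintype.card ι ≤ ∑ x, capacity b N (e x) + N := by
    refine le_trans ?_ (Nat.add_le_add_left hsum _)
    rw [← sum_add_distrib, mul_comm, ← smul_eq_mul]
    refine card_nsmul_le_sum _ _ _ fun x _ => Nat.sub_le_iff_le_add.mp ?_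
    rw [le_capacity_iff (he x) (Nat.sub_le _ _), Nat.mul_sub]
    have : e x ≤ b * e x := by
      rcases b.eq_zero_or_pos with rfl | hb
      · simpa using he x
      · exact Nat.le_mul_of_pos_left _ hb
    have : e x ≤ N := (single_le_sum (fun _ _ => Nat.zero_le _) (mem_univ x)).trans hsum
    have := Nat.mul_le_mul_left b this
    omega
  rw [hadd, add_mul]
  rcases lt_trichotomy (Fintype.card ι) ℓ with h | rfl | h
  · have := Nat.mul_lt_mul_of_pos_left h hN
    have := Nat.mul_le_mul_left u h.le
    omega
  · omega
  · have := Nat.mul_le_mul_left N (show ℓ + 1 ≤ Fintype.card ι from h)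
    have := Nat.mul_le_mul_left u h.le
    rw [mul_add_one] at *
    omega

theorem feasible_min_iff {N : ℕ} (hN : ∑ x, (s x + 1) ≤ N) :
    Feasible prio c s ℓ b d (min t N) ↔ Feasible prio c s ℓ b d t := by
  rcases le_total t N with h | h
  · rw [min_eq_left h]
  rw [min_eq_right h]
  have hsN : ∀ x, s x + 1 ≤ N := fun x =>
    (single_le_sum (f := fun x => s x + 1) (fun _ _ => Nat.zero_le _) (mem_univ x)).trans hN
  have hsum : ∑ x, excess prio c s d N x ≤ N := (sum_le_sum fun x _ => excess_le x).trans hN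
  obtain ⟨u, rfl⟩ := Nat.exists_eq_add_of_le h
  simp only [Feasible, excess_eq_of_le (hsN _) h]
  have hexcess : (∀ x, excess prio c s d N x ≤ b * (N + u)) ↔
      ∀ x, excess prio c s d N x ≤ b * N := by
    rcases b.eq_zero_or_pos with rfl | hb
    · simp
    · have hx : ∀ x, excess prio c s d N x ≤ b * N := fun x =>
        (excess_le x).trans ((hsN x).trans (Nat.le_mul_of_pos_left N hb))
      exact iff_of_true (fun x => (hx x).trans (Nat.mul_le_mul_left b h)) hx
  rw [hexcess]
  exact and_congr_right fun he =>
    (le_sum_capacity_add_iff ((Nat.succ_pos _).trans_le (hsN c)) he hsum u).symm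

end Feasible

section Parsing

instance : Inhabited Sym := ⟨Sym.comma⟩

/-- The number at the beginning of a string, cut off at `N`. -/
def readNat (N : ℕ) : List Sym → ℕ
  | Sym.bit β :: l => min (2 * readNat N l + β.toNat) N
  | _ => 0

/-- The part of the string `w` after the first occurrence of `z`. -/
def after (z : Sym) (w : List Sym) : List Sym := (w.dropWhile (· ≠ z)).tail

/-- Whether a list of numbers that is ended by a semicolon, or by the end of the string, has an
entry at the beginning of the given string: `1` if so, and `0` if not. -/
def hasEntry : List Sym → ℕ
  | [] => 0
  | Sym.semi :: _ => 0
  | _ => 1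

/-- The weight of an entry behind the given symbol: `p` at the head of a list, which is preceded by
the semicolon of another list, and `q` for the other entries. -/
def weight (p q : ℕ) : Sym → ℕ
  | Sym.semi => p
  | Sym.comma => q
  | Sym.bit _ => 0

/-- The weighted sum of `g` over the entries of a string of lists of numbers; `g` is applied to the
strings that begin with the entries. -/
def entrySum (p q : ℕ) (g : List Sym → ℕ) : List Sym → ℕ :=
  suffixSum fun z l => weight p q z * (hasEntry l * g l)

theorem readNat_encodePosNum (N : ℕ) (p : PosNum) (l : List Sym) :
    readNat N ((Computability.encodePosNum p).map Sym.bit ++ Sym.comma :: l) = min (p : ℕ) N := by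
  induction p with
  | one => simp [Computability.encodePosNum, readNat]
  | bit0 p ih =>
    simp only [Computability.encodePosNum, List.map_cons, List.cons_append, readNat, ih,
      PosNum.cast_bit0, Bool.toNat_false]
    omega
  | bit1 p ih =>
    simp only [Computability.encodePosNum, List.map_cons, List.cons_append, readNat, ih,
      PosNum.cast_bit1, Bool.toNat_true]
    omega

theorem readNat_encodeNum (N n : ℕ) (l : List Sym) : readNat N (encodeNum n ++ l) = min n N := by
  have hnum : ∀ p : Num,
      readNat N ((Computability.encodeNum p).map Sym.bit ++ Sym.comma :: l) = min (p : ℕ) N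
    | .zero => (N.zero_min).symm
    | .pos p => readNat_encodePosNum N p l
  simpa [encodeNum, Computability.encodeNat] using hnum n

theorem after_append {z : Sym} {u : List Sym} (hu : z ∉ u) (v : List Sym) :
    after z (u ++ z :: v) = v := by
  rw [after, List.dropWhile_append_of_pos fun y hy => by simpa using ne_of_mem_of_not_mem hy hu]
  simp

theorem takeWhile_ne_append {z : Sym} {u : List Sym} (hu : z ∉ u) (v : List Sym) :
    (u ++ z :: v).takeWhile (· ≠ z) = u := by
  rw [List.takeWhile_append_of_pos fun y hy => by simpa using ne_of_mem_of_not_mem hy hu]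
  simp

theorem after_comma_encodeNum (n : ℕ) (l : List Sym) :
    after Sym.comma (encodeNum n ++ l) = l := by
  simpa [encodeNum] using after_append
    (u := (Computability.encodeNat n).map Sym.bit) (by simp) l

theorem semi_notMem_flatMap_encodeNum (ns : List ℕ) : Sym.semi ∉ ns.flatMap encodeNum := by
  simp [encodeNum]

theorem hasEntry_encodeNum (n : ℕ) (l : List Sym) : hasEntry (encodeNum n ++ l) = 1 := by
  unfold encodeNum
  rcases Computability.encodeNat n with _ | ⟨β, u⟩ <;> rfl

variable {p q N : ℕ} {g : List Sym → ℕ}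

theorem entrySum_nil : entrySum p q g [] = 0 := rfl

theorem entrySum_cons_of_hasEntry_eq_zero {l : List Sym} (hl : hasEntry l = 0) (z : Sym) :
    entrySum p q g (z :: l) = entrySum p q g l := by
  simp [entrySum, suffixSum, hl]

theorem entrySum_encodeNum (n : ℕ) (l : List Sym) :
    entrySum p q g (encodeNum n ++ l) = entrySum p q g (Sym.comma :: l) := by
  simp only [encodeNum, List.append_assoc, List.singleton_append]
  induction Computability.encodeNat n with
  | nil => rfl
  | cons β u ih =>
    rw [List.map_cons, List.cons_append, ← ih]
    simp [entrySum, suffixSum, weight]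

theorem entrySum_cons_encodeNum (z : Sym) (n : ℕ) (l : List Sym) :
    entrySum p q g (z :: (encodeNum n ++ l)) =
      weight p q z * g (encodeNum n ++ l) + entrySum p q g (Sym.comma :: l) := by
  rw [← entrySum_encodeNum n l, entrySum, suffixSum, hasEntry_encodeNum, one_mul]

theorem entrySum_flatMap_encodeNum (ns : List ℕ) {w : List Sym} (hw : hasEntry w = 0) :
    entrySum p q g (Sym.comma :: (ns.flatMap encodeNum ++ w)) =
      q * ∑ i ∈ range ns.length, g ((ns.drop i).flatMap encodeNum ++ w) + entrySum p q g w := by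
  induction ns with
  | nil => simpa using entrySum_cons_of_hasEntry_eq_zero hw Sym.comma
  | cons n ns ih =>
    rw [List.flatMap_cons, List.append_assoc, entrySum_cons_encodeNum, ih, List.length_cons,
      sum_range_succ']
    simp only [List.drop_succ_cons, List.drop_zero, List.flatMap_cons, List.append_assoc, weight]
    ring

theorem entrySum_readNat_eq {ns : List ℕ} (hns : ∀ n ∈ ns, n ≤ N) (x : ℕ) {w : List Sym}
    (hw : hasEntry w = 0) :
    entrySum p q (fun l => if readNat N l = x then 1 else 0)
        (Sym.comma :: (ns.flatMap encodeNum ++ w)) =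
      q * ns.count x + entrySum p q (fun l => if readNat N l = x then 1 else 0) w := by
  induction ns with
  | nil => simpa using entrySum_cons_of_hasEntry_eq_zero hw Sym.comma
  | cons n ns ih =>
    rw [List.forall_mem_cons] at hns
    rw [List.flatMap_cons, List.append_assoc, entrySum_cons_encodeNum, ih hns.2, readNat_encodeNum,
      min_eq_left hns.1, List.count_cons]
    simp only [weight, beq_iff_eq]
    ring

theorem polyTime_readNat {α : Type} [Storable Sym α] {M : α → ℕ} {f : α → List Sym}
    (hM : PolyTime Sym M) (hf : PolyTime Sym f) : PolyTime Sym fun x => readNat (M x) (f x) := by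
  refine PolyTime.listRec (F := fun x l => readNat (M x) l)
    (step := fun z s => match z with
      | Sym.bit β => min (2 * s.2.2 + β.toNat) (M s.1)
      | _ => 0) .zero (fun z => ?_) (fun _ => rfl) (fun _ z _ => by cases z <;> rfl)
    ((hM.comp .fst).polyBounded.of_le fun s => ?_) hf
  · cases z with
    | bit β =>
      exact (((PolyTime.const 2).mul (PolyTime.snd.comp .snd)).add (.const _)).min (hM.comp .fst)
    | _ => exact .zero
  · rw [length_toList_nat]
    unfold readNat
    split <;> simp

theorem polyTime_after {α : Type} [Storable Sym α] (z : Sym) {f : α → List Sym}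
    (hf : PolyTime Sym f) : PolyTime Sym fun x => after z (f x) :=
  (hf.dropWhile _).tail

theorem polyTime_hasEntry {α : Type} [Storable Sym α] {f : α → List Sym} (hf : PolyTime Sym f) :
    PolyTime Sym fun x => hasEntry (f x) :=
  PolyTime.listRec (F := fun _ l => hasEntry l)
    (step := fun z _ => match z with
      | Sym.semi => 0
      | _ => 1) .zero (fun z => by cases z <;> exact .const _) (fun _ => rfl)
    (fun _ z _ => by cases z <;> rfl)
    ((PolyBounded.const _ 1).of_le fun s => by
      rw [length_toList_nat]
      unfold hasEntry
      split <;> simp) hf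

theorem polyTime_entrySum {α : Type} [Storable Sym α] {g : α × List Sym → ℕ} {f : α → List Sym}
    (hg : PolyTime Sym g) (hf : PolyTime Sym f) (p q : ℕ) :
    PolyTime Sym fun x => entrySum p q (fun l => g (x, l)) (f x) :=
  PolyTime.suffixSum (fun z => (PolyTime.const (weight p q z)).mul
    ((polyTime_hasEntry .snd).mul hg)) hf

end Parsing

section Algorithm

variable {ℓ k m b d t N : ℕ}

/-- The score of the candidate `x` in the votes that the string `V` represents. -/
def scoreIn (b d N : ℕ) (V : List Sym) (x : ℕ) : ℕ :=
  entrySum (b + d) b (fun l => if readNat N l = x then 1 else 0) (Sym.semi :: V)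

/-- The excess of the candidate whose name begins the string `l` of candidates in order of priority.
In this order, a candidate beats the target `c` in ties if and only if `c` comes later. -/
def excessIn (b d N : ℕ) (V : List Sym) (c t : ℕ) (l : List Sym) : ℕ :=
  scoreIn b d N V (readNat N l) + entrySum 0 1 (fun l => if readNat N l = c then 1 else 0) l -
    (scoreIn b d N V c + t * d)

/-- The amount by which the inequalities of `Feasible` are violated, with candidates `C`. -/
def violation (ℓ b d N : ℕ) (C V : List Sym) (c t : ℕ) : ℕ :=
  entrySum 0 1 (fun l => excessIn b d N V c t l - b * t) (Sym.comma :: C) +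
    (t * ℓ - entrySum 0 1 (fun l => capacity b t (excessIn b d N V c t l)) (Sym.comma :: C))

/-- The violation, as a function of the input string. -/
def inputViolation (ℓ b d N : ℕ) (w : List Sym) : ℕ :=
  violation ℓ b d N ((after .comma (after .comma w)).takeWhile (· ≠ Sym.semi))
    (after .semi (after .comma (after .comma w))) (readNat N w) (readNat N (after .comma w))

theorem count_ofFn {n : ℕ} (u : Fin n → ℕ) (x : ℕ) :
    (List.ofFn u).count x = ∑ j, if u j = x then 1 else 0 := by
  induction n with
  | zero => simp
  | succ n ih =>
    simp only [List.ofFn_succ, List.count_cons, ih, Fin.sum_univ_succ, beq_iff_eq, add_comm]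

theorem scoreIn_eq {a : Fin (k + 1) → ℕ} (hb : ∀ j : Fin k, a j.succ = b) (hd : a 0 = b + d)
    (hN : m ≤ N) (P : List (TopRanking (k + 1) m)) (x : Fin m) :
    scoreIn b d N (P.flatMap fun v => encodeNums (List.ofFn fun j => (v j : ℕ))) x =
      score a P x := by
  induction P with
  | nil =>
    rw [scoreIn, List.flatMap_nil, entrySum_cons_of_hasEntry_eq_zero rfl, entrySum_nil]
    rfl
  | cons v P ih =>
    have hnames : ∀ n ∈ List.ofFn fun j : Fin k => (v j.succ : ℕ), n ≤ N :=
      List.forall_mem_ofFn_iff.mpr fun j => (v j.succ).isLt.le.trans hN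
    rw [score_cons, ← ih, voteScore, Fin.sum_univ_succ, scoreIn, List.flatMap_cons, encodeNums,
      List.ofFn_succ, List.flatMap_cons, List.append_assoc, List.append_assoc,
      List.singleton_append, entrySum_cons_encodeNum, entrySum_readNat_eq hnames x rfl,
      readNat_encodeNum, min_eq_left ((v 0).isLt.le.trans hN), count_ofFn]
    simp only [weight, hb, hd, Fin.ext_iff, mul_sum, mul_ite, mul_one, mul_zero, add_assoc,
      scoreIn]

theorem count_drop_succ_ofFn (prio : Fin m ≃ Fin m) (c i : Fin m) :
    ((List.ofFn fun i => (prio i : ℕ)).drop (i + 1)).count (c : ℕ) =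
      tieBonus prio c (prio i) := by
  have hnodup : (List.ofFn fun i => (prio i : ℕ)).Nodup :=
    List.nodup_ofFn.mpr (Fin.val_injective.comp prio.injective)
  rw [List.Nodup.count (hnodup.sublist (List.drop_sublist _ _)), tieBonus, prio.symm_apply_apply]
  refine if_congr ?_ rfl rfl
  simp only [List.mem_drop_iff_getElem, List.getElem_ofFn, List.length_ofFn]
  refine ⟨?_, fun h => ⟨prio.symm c - (i + 1), by omega, ?_⟩⟩
  · rintro ⟨j, hj, hc⟩
    rw [← Fin.ext hc, prio.symm_apply_apply, Fin.lt_def]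
    exact Nat.lt_add_right j (Nat.lt_succ_self i)
  · simp [Nat.add_sub_cancel' (show (i : ℕ) + 1 ≤ prio.symm c from h)]

theorem excessIn_eq (hN : m ≤ N) {prio : Fin m ≃ Fin m} {c : Fin m} {s : Fin m → ℕ} {V : List Sym}
    (hs : ∀ x : Fin m, scoreIn b d N V x = s x) (t : ℕ) (i : Fin m) :
    excessIn b d N V c t (((List.ofFn fun i => (prio i : ℕ)).drop i).flatMap encodeNum) =
      excess prio c s d t (prio i) := by
  have hname : ∀ j, (prio j : ℕ) ≤ N := fun j => (prio j).isLt.le.trans hN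
  have hnames : ∀ n ∈ (List.ofFn fun i => (prio i : ℕ)).drop (i + 1), n ≤ N := fun n hn =>
    (List.forall_mem_ofFn_iff (P := (· ≤ N))).mpr hname n (List.mem_of_mem_drop hn)
  have hbonus := entrySum_readNat_eq (p := 0) (q := 1) hnames c (w := []) rfl
  rw [List.append_nil, count_drop_succ_ofFn, one_mul, entrySum_nil, add_zero] at hbonus
  rw [List.drop_eq_getElem_cons (by simp), List.flatMap_cons, List.getElem_ofFn, excessIn,
    readNat_encodeNum, min_eq_left (hname _), entrySum_encodeNum, hbonus,
    hs, hs, excess]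

theorem entrySum_candidates (g : List Sym → ℕ) (u : Fin m → ℕ) :
    entrySum 0 1 g (Sym.comma :: (List.ofFn u).flatMap encodeNum) =
      ∑ i : Fin m, g (((List.ofFn u).drop i).flatMap encodeNum) := by
  simpa [sum_range, entrySum_nil] using
    entrySum_flatMap_encodeNum (p := 0) (q := 1) (g := g) (List.ofFn u) (w := []) rfl

theorem violation_eq_zero_iff (hN : m ≤ N) {prio : Fin m ≃ Fin m} {c : Fin m} {s : Fin m → ℕ}
    {V : List Sym} (hs : ∀ x : Fin m, scoreIn b d N V x = s x) :
    violation ℓ b d N ((List.ofFn fun i => (prio i : ℕ)).flatMap encodeNum) V c t = 0 ↔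
      Feasible prio c s ℓ b d t := by
  simp only [violation, entrySum_candidates, excessIn_eq hN hs, Feasible]
  rw [Equiv.sum_comp prio fun x => excess prio c s d t x - b * t,
    Equiv.sum_comp prio fun x => capacity b t (excess prio c s d t x)]
  simp [Nat.sub_eq_zero_iff_le]

theorem inputViolation_encode (I : Instance ℓ) (hN : I.m ≤ N) :
    inputViolation ℓ b d N (encode I) =
      violation ℓ b d N ((List.ofFn fun i => (I.prio i : ℕ)).flatMap encodeNum)
        (I.known.flatMap fun v => encodeNums (List.ofFn fun j => (v j : ℕ))) I.target
        (min I.t N) := by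
  have hsemi := semi_notMem_flatMap_encodeNum (List.ofFn fun i => (I.prio i : ℕ))
  simp only [inputViolation, encode, encodeNums, List.append_assoc, List.singleton_append,
    after_comma_encodeNum, readNat_encodeNum, after_append hsemi, takeWhile_ne_append hsemi,
    min_eq_left (I.target.isLt.le.trans hN)]

theorem length_le_length_flatMap {α β : Type} {f : α → List β} (hf : ∀ x, f x ≠ []) (l : List α) :
    l.length ≤ (l.flatMap f).length := by
  have hpos : ∀ y ∈ l.map fun x => (f x).length, 1 ≤ y :=
    List.forall_mem_map.mpr fun x _ => List.length_pos_iff.mpr (hf x)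
  simpa using List.length_le_sum_of_one_le _ hpos

theorem m_add_length_known_le (I : Instance ℓ) : I.m + I.known.length ≤ (encode I).length := by
  have hcandidates := length_le_length_flatMap (f := encodeNum) (by simp [encodeNum])
    (List.ofFn fun i => (I.prio i : ℕ))
  have hvotes := length_le_length_flatMap
    (f := fun v : TopRanking ℓ I.m => encodeNums (List.ofFn fun j => (v j : ℕ)))
    (by simp [encodeNums]) I.known
  rw [List.length_ofFn] at hcandidates
  simp only [encode, encodeNums, List.length_append] at hvotes ⊢
  omega

theorem inputViolation_encode_eq_zero_iff {a : Fin (k + 1) → ℕ} (hb : ∀ j : Fin k, a j.succ = b)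
    (hd : a 0 = b + d) (I : Instance (k + 1)) :
    inputViolation (k + 1) b d ((∑ j, a j + 1) * (encode I).length) (encode I) = 0 ↔ IsYes a I := by
  have hN : ∑ x, (score a I.known x + 1) ≤ (∑ j, a j + 1) * (encode I).length := by
    refine le_trans ?_ (Nat.mul_le_mul_left _ (m_add_length_known_le I))
    rw [sum_add_distrib, sum_score]
    simp only [sum_const, card_univ, Fintype.card_fin, smul_eq_mul, mul_one]
    rw [add_one_mul, mul_add, mul_comm]
    have := Nat.zero_le ((∑ j, a j) * I.m)
    omega
  have hm : I.m ≤ (∑ j, a j + 1) * (encode I).length := by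
    refine le_trans ?_ hN
    simp [sum_add_distrib]
  rw [inputViolation_encode I hm, violation_eq_zero_iff hm fun x => scoreIn_eq hb hd hm I.known x,
    feasible_min_iff hN, isYes_iff_feasible hb hd]

end Algorithm

section RunningTime

variable {α : Type} [Storable Sym α] {N c t x : α → ℕ} {C V l : α → List Sym}

theorem polyTime_capacity (b : ℕ) {e : α → ℕ} (ht : PolyTime Sym t) (he : PolyTime Sym e) :
    PolyTime Sym fun y => capacity b (t y) (e y) := by
  simp only [capacity, Nat.count_eq_card_filter_range, card_filter]
  exact PolyTime.sum_range (g := fun q => if e q.1 ≤ b * q.2 then 1 else 0)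
    ((he.comp .fst).ite_le ((PolyTime.const b).mul .snd)) ht

theorem polyTime_entrySum_readNat_eq (p q : ℕ) (hN : PolyTime Sym N) (hx : PolyTime Sym x)
    (hl : PolyTime Sym l) :
    PolyTime Sym fun y => entrySum p q (fun w => if readNat (N y) w = x y then 1 else 0) (l y) :=
  polyTime_entrySum (g := fun s => if readNat (N s.1) s.2 = x s.1 then 1 else 0)
    ((polyTime_readNat (hN.comp .fst) .snd).ite_eq (hx.comp .fst)) hl p q

theorem polyTime_scoreIn (b d : ℕ) (hN : PolyTime Sym N) (hV : PolyTime Sym V)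
    (hx : PolyTime Sym x) : PolyTime Sym fun y => scoreIn b d (N y) (V y) (x y) :=
  polyTime_entrySum_readNat_eq (b + d) b hN hx (hV.cons Sym.semi)

theorem polyTime_excessIn (b d : ℕ) (hN : PolyTime Sym N) (hV : PolyTime Sym V)
    (hc : PolyTime Sym c) (ht : PolyTime Sym t) (hl : PolyTime Sym l) :
    PolyTime Sym fun y => excessIn b d (N y) (V y) (c y) (t y) (l y) :=
  ((polyTime_scoreIn b d hN hV (polyTime_readNat hN hl)).add
    (polyTime_entrySum_readNat_eq 0 1 hN hc hl)).sub
      ((polyTime_scoreIn b d hN hV hc).add (ht.mul (.const d)))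

theorem polyTime_violation (ℓ b d : ℕ) (hN : PolyTime Sym N) (hC : PolyTime Sym C)
    (hV : PolyTime Sym V) (hc : PolyTime Sym c) (ht : PolyTime Sym t) :
    PolyTime Sym fun y => violation ℓ b d (N y) (C y) (V y) (c y) (t y) := by
  have he : PolyTime Sym fun s : α × List Sym =>
      excessIn b d (N s.1) (V s.1) (c s.1) (t s.1) s.2 :=
    polyTime_excessIn b d (hN.comp .fst) (hV.comp .fst) (hc.comp .fst) (ht.comp .fst) .snd
  exact (polyTime_entrySum (he.sub ((PolyTime.const b).mul (ht.comp .fst))) (hC.cons _) 0 1).add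
    ((ht.mul (.const ℓ)).sub
      (polyTime_entrySum (polyTime_capacity b (ht.comp .fst) he) (hC.cons _) 0 1))

theorem polyTime_inputViolation (ℓ b d : ℕ) (hN : PolyTime Sym N) (hl : PolyTime Sym l) :
    PolyTime Sym fun y => inputViolation ℓ b d (N y) (l y) := by
  have hl₁ := polyTime_after .comma hl
  have hl₂ := polyTime_after .comma hl₁
  exact polyTime_violation ℓ b d hN (hl₂.takeWhile _) (polyTime_after .semi hl₂)
    (polyTime_readNat hN hl) (polyTime_readNat hN hl₁)

end RunningTime

end WAV

theorem theorem7_general {k b d : ℕ} {a : Fin (k + 1) → ℕ} (hb : ∀ j : Fin k, a j.succ = b)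
    (hd : a 0 = b + d) :
    WAV.DecidableInPolyTime (WAV.encode (ℓ := k + 1)) (WAV.IsYes a) :=
  decidableInPolyTime_of_polyTime
    (WAV.polyTime_inputViolation (k + 1) b d ((PolyTime.const _).mul PolyTime.id.length) .id)
    (WAV.inputViolation_encode_eq_zero_iff hb hd)

theorem theorem7 (ℓ : ℕ) (hℓ : 2 ≤ ℓ) (a : Fin ℓ → ℕ) (ha : Antitone a)
    (htail : ∀ i j : Fin ℓ, 1 ≤ (i : ℕ) → 1 ≤ (j : ℕ) → a i = a j) :
    WAV.DecidableInPolyTime (WAV.encode (ℓ := ℓ)) (WAV.IsYes a) := by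
  obtain ⟨k, rfl⟩ := Nat.exists_eq_add_of_le' (one_le_two.trans hℓ)
  obtain ⟨d, hd⟩ := Nat.exists_eq_add_of_le (ha (Fin.zero_le ⟨1, hℓ⟩))
  exact theorem7_general (fun j => htail _ _ (by simp) le_rfl) hd
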